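/- Let $n\ge 1$ and let $\Omega\subset\mathbb R^n$ be an open, bounded, strictly convex domain (i.e. $\Omega$ is convex and $\partial\Omega$ contains no non-degenerate line segment). Let $\mu$ be a Borel measure on $\Omega$ with $\mu(\Omega)<\infty$, and let $g\in C(\partial\Omega)$. Then there is exactly one function $u\in C(\overline\Omega)$ such that $u$ is convex in $\Omega$, $u=g$ on $\partial\Omega$, and $\det D^2u=\mu$ in $\Omega$ in the sense of Aleksandrov, that is, $$\Big|\bigcup_{x\in E}\partial u(x)\Big|=\mu(E)\qquad\text{for every Borel set }E\subset\Omega,$$ where $|\cdot|$ is Lebesgue measure on $\mathbb R^n$ and, for $x\in\Omega$, $$\partial u(x)=\{p\in\mathbb R^n:\ u(y)\ge u(x)+p\cdot(y-x)\ \text{ for all } y\in\Omega\}.$$ -/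

import Mathlib

open MeasureTheory
open scoped ENNReal

/-- The normal mapping (subdifferential) of `u : Ω → ℝ` at `x`: the slopes `p` of the affine functions
`y ↦ u x + p · (y - x)` that lie below `u` on all of `Ω`. Only the values of `u` on `Ω` matter
when `x ∈ Ω`. -/
def normalMapping {n : ℕ} (Ω : Set (EuclideanSpace ℝ (Fin n))) (u : EuclideanSpace ℝ (Fin n) → ℝ)
    (x : EuclideanSpace ℝ (Fin n)) : Set (EuclideanSpace ℝ (Fin n)) :=
  {p | ∀ y ∈ Ω, u x + inner ℝ p (y - x) ≤ u y}

/-- The image `∂u(A) = ⋃_{x ∈ A} ∂u(x)` of a set under the normal mapping. -/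
def normalImage {n : ℕ} (Ω : Set (EuclideanSpace ℝ (Fin n))) (u : EuclideanSpace ℝ (Fin n) → ℝ)
    (A : Set (EuclideanSpace ℝ (Fin n))) : Set (EuclideanSpace ℝ (Fin n)) :=
  ⋃ x ∈ A, normalMapping Ω u x

/-- The Monge–Ampère measure `Mu(A) = |∂u(A)|`, with `|·|` the `n`-dimensional Lebesgue measure. -/
noncomputable def mongeAmpere {n : ℕ} (Ω : Set (EuclideanSpace ℝ (Fin n)))
    (u : EuclideanSpace ℝ (Fin n) → ℝ) (A : Set (EuclideanSpace ℝ (Fin n))) : ℝ≥0∞ :=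
  volume (normalImage Ω u A)

/-- `u` is an Aleksandrov solution of `det D²u = μ` in `Ω`: it is convex on `Ω`, and `Mu = μ` on
the Borel subsets of `Ω`. -/
structure IsAleksandrovSolution {n : ℕ} (Ω : Set (EuclideanSpace ℝ (Fin n)))
    (μ : Measure (EuclideanSpace ℝ (Fin n))) (u : EuclideanSpace ℝ (Fin n) → ℝ) : Prop where
  convexOn : ConvexOn ℝ Ω u
  mongeAmpere_eq : ∀ A : Set (EuclideanSpace ℝ (Fin n)), A ⊆ Ω → MeasurableSet A →
    mongeAmpere Ω u A = μ A

/-- `u ∈ C(closure Ω)` solves `det D²u = μ` in `Ω` in the sense of Aleksandrov, with `u = g` on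
the boundary of `Ω`. Only the values of `u` on `closure Ω` matter. -/
structure IsDirichletSolution {n : ℕ} (Ω : Set (EuclideanSpace ℝ (Fin n)))
    (μ : Measure (EuclideanSpace ℝ (Fin n))) (g u : EuclideanSpace ℝ (Fin n) → ℝ) : Prop where
  continuousOn : ContinuousOn u (closure Ω)
  isAleksandrovSolution : IsAleksandrovSolution Ω μ u
  eqOn_frontier : Set.EqOn u g (frontier Ω)

/-!
The solution is found by a variational argument on the side of the convex conjugate.

Write `H` for the conjugate `p ↦ max_{y ∈ ∂Ω} (p · y - g y)` of the boundary data, and for a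
function `φ ≥ H` of the slope let `u x = sup_p (x · p - φ p)`. Consider the energy `∫ (φ - H) dp +
∫_Ω u dμ` (`dualEnergy`, with a constant added to `u`). A perturbation of `u` by a test function `f`
supported in `Ω` changes the conjugate of `u` at the slope `p` to first order by `-f (∇φ p)`, since
`∇φ p` is the point where `x · p - u x` is maximal. So a minimiser satisfies `∫ f (∇φ p) dp = ∫_Ω f
dμ`: the gradient of the conjugate pushes Lebesgue measure forward to `μ` on `Ω`. As the normal
image of `A` agrees up to a null set with the preimage of `A` under this gradient
(`normalImage_ae_eq_preimage_gradient`), that is the Monge–Ampère equation.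

A minimiser exists because the functions `φ` may be taken uniformly Lipschitz, so that minimising
sequences converge pointwise along a subsequence and Fatou's lemma applies to both integrals; it
does not meet the constraint bounding `φ 0`, by `exists_minimizer_lt`. The boundary condition comes
from the finiteness of the energy: a nonnegative Lipschitz function that is integrable tends to `0`
at infinity, so `φ` is close to `H` at the steep slopes normal to a hyperplane that touches the
closure of `Ω` at one boundary point only, and these slopes give barriers there
(`exists_abs_conjugateOn_sub_le`). This is where strict convexity is used.

For uniqueness, suppose `v - u` is somewhere positive for two solutions. A function `w = (1 + e) v -
c` is then below `u` on the boundary and above it somewhere. With `G = {u < w}` one has `∂w(G) ⊆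
∂u(G)`, hence `(1 + e)ⁿ μ G ≤ μ G`; but `∂u(G)` contains a ball, so `0 < μ G < ∞`
(`IsDirichletSolution.le_of_isDirichletSolution`).
-/

open Set Filter Topology
open scoped NNReal Pointwise

/-! ### Convex conjugates of functions on a set -/

section Conjugate

variable {E : Type*} [NormedAddCommGroup E] [InnerProductSpace ℝ E]

/-- The convex conjugate of `w` restricted to `S`, i.e. `p ↦ sup_{x ∈ S} (p · x - w x)`. It is only
meaningful where the supremum is that of a nonempty set bounded above. -/
noncomputable def conjugateOn (S : Set E) (w : E → ℝ) (p : E) : ℝ :=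
  sSup ((fun x => inner ℝ p x - w x) '' S)

lemma le_conjugateOn {S : Set E} {w : E → ℝ} {p x : E}
    (hb : BddAbove ((fun x => inner ℝ p x - w x) '' S)) (hx : x ∈ S) :
    inner ℝ p x - w x ≤ conjugateOn S w p :=
  le_csSup hb (mem_image_of_mem _ hx)

lemma conjugateOn_le {S : Set E} (hS : S.Nonempty) {w : E → ℝ} {p : E} {c : ℝ}
    (h : ∀ x ∈ S, inner ℝ p x - w x ≤ c) : conjugateOn S w p ≤ c := by
  refine csSup_le (hS.image _) ?_
  rintro _ ⟨x, hx, rfl⟩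
  exact h x hx

lemma bddAbove_conjugateOn {S : Set E} (hS : IsCompact S) {w : E → ℝ} (hw : ContinuousOn w S)
    (p : E) : BddAbove ((fun x => inner ℝ p x - w x) '' S) :=
  hS.bddAbove_image ((by fun_prop : ContinuousOn (fun x => inner ℝ p x) S).sub hw)

/-- On a nonempty compact set the supremum defining the conjugate is attained. -/
lemma exists_conjugateOn_eq {S : Set E} (hS : IsCompact S) (hne : S.Nonempty) {w : E → ℝ}
    (hw : ContinuousOn w S) (p : E) : ∃ x ∈ S, conjugateOn S w p = inner ℝ p x - w x := by
  obtain ⟨x, hx, hmax⟩ := hS.exists_isMaxOn hne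
    ((by fun_prop : ContinuousOn (fun x => inner ℝ p x) S).sub hw)
  exact ⟨x, hx, le_antisymm (conjugateOn_le hne fun y hy => hmax hy)
    (le_conjugateOn (bddAbove_conjugateOn hS hw p) hx)⟩

lemma lipschitzWith_conjugateOn {S : Set E} (hS : IsCompact S) (hne : S.Nonempty) {w : E → ℝ}
    (hw : ContinuousOn w S) {D : ℝ≥0} (hD : ∀ x ∈ S, ‖x‖ ≤ D) :
    LipschitzWith D (conjugateOn S w) := by
  refine LipschitzWith.of_le_add_mul D fun p q => conjugateOn_le hne fun x hx => ?_
  have h1 := le_conjugateOn (bddAbove_conjugateOn hS hw q) hx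
  have h2 : inner ℝ (p - q) x ≤ D * dist p q := by
    calc inner ℝ (p - q) x ≤ ‖p - q‖ * ‖x‖ := real_inner_le_norm _ _
      _ ≤ ‖p - q‖ * D := by gcongr; exact hD x hx
      _ = D * dist p q := by rw [dist_eq_norm, mul_comm]
  rw [inner_sub_left] at h2
  linarith

lemma convexOn_conjugateOn {S K : Set E} (hne : S.Nonempty) (hK : Convex ℝ K) {w : E → ℝ}
    (hb : ∀ p ∈ K, BddAbove ((fun x => inner ℝ p x - w x) '' S)) :
    ConvexOn ℝ K (conjugateOn S w) := by
  refine ⟨hK, fun p hp q hq a b ha hb' hab => conjugateOn_le hne fun x hx => ?_⟩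
  have h1 := mul_le_mul_of_nonneg_left (le_conjugateOn (hb p hp) hx) ha
  have h2 := mul_le_mul_of_nonneg_left (le_conjugateOn (hb q hq) hx) hb'
  simp only [inner_add_left, real_inner_smul_left, smul_eq_mul]
  have h3 : w x = a * w x + b * w x := by rw [← add_mul, hab, one_mul]
  linarith

/-- A point where the conjugate is attained is the gradient of the conjugate, wherever the latter is
differentiable. -/
lemma eq_gradient_of_conjugateOn_eq [CompleteSpace E] {S : Set E} (hS : IsCompact S) {w : E → ℝ}
    (hw : ContinuousOn w S) {p x : E} (hx : x ∈ S) (h : conjugateOn S w p = inner ℝ p x - w x)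
    (hd : DifferentiableAt ℝ (conjugateOn S w) p) : gradient (conjugateOn S w) p = x := by
  have hmin : IsLocalMin (fun q => conjugateOn S w q - inner ℝ x q) p := by
    refine Eventually.of_forall fun q => ?_
    have := le_conjugateOn (bddAbove_conjugateOn hS hw q) hx
    change conjugateOn S w p - inner ℝ x p ≤ conjugateOn S w q - inner ℝ x q
    rw [real_inner_comm q x, real_inner_comm p x]
    linarith
  have h1 : HasFDerivAt (fun q => conjugateOn S w q - inner ℝ x q)
      (fderiv ℝ (conjugateOn S w) p - innerSL ℝ x) p :=
    hd.hasFDerivAt.sub (innerSL ℝ x).hasFDerivAt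
  have h2 := sub_eq_zero.1 (hmin.hasFDerivAt_eq_zero h1)
  rw [gradient, h2]
  exact (InnerProductSpace.toDual ℝ E).symm_apply_apply x

end Conjugate

/-! ### Supporting hyperplanes and barriers -/

section ConvexDomain

lemma isCompact_frontier_of_isBounded {E : Type*} [PseudoMetricSpace E] [ProperSpace E] {Ω : Set E}
    (hb : Bornology.IsBounded Ω) : IsCompact (frontier Ω) :=
  hb.isCompact_closure.of_isClosed_subset isClosed_frontier frontier_subset_closure

lemma frontier_nonempty_of_isBounded {E : Type*} [NormedAddCommGroup E] [NormedSpace ℝ E]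
    [Nontrivial E] {Ω : Set E} (hb : Bornology.IsBounded Ω)
    (hne : Ω.Nonempty) : (frontier Ω).Nonempty := by
  refine nonempty_frontier_iff.2 ⟨hne, ?_⟩
  rintro rfl
  exact NormedSpace.unbounded_univ ℝ E hb

variable {E : Type*} [NormedAddCommGroup E] [InnerProductSpace ℝ E] [FiniteDimensional ℝ E]

/-- A linear functional bounded on the boundary of a bounded open set is bounded by the same
constant on its closure. -/
lemma inner_le_of_forall_frontier [Nontrivial E] {Ω : Set E} (ho : IsOpen Ω)
    (hb : Bornology.IsBounded Ω) {q : E} {c : ℝ} (h : ∀ y ∈ frontier Ω, inner ℝ q y ≤ c) {x : E}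
    (hx : x ∈ closure Ω) : inner ℝ q x ≤ c := by
  obtain ⟨z, hz, hmax⟩ := hb.isCompact_closure.exists_isMaxOn ⟨x, hx⟩
    (by fun_prop : ContinuousOn (fun x => inner ℝ q x) (closure Ω))
  by_cases hzΩ : z ∈ Ω
  · have hloc : IsLocalMax (fun x => inner ℝ q x) z :=
      hmax.isLocalMax (mem_of_superset (ho.mem_nhds hzΩ) subset_closure)
    have h0 : innerSL ℝ q = 0 := hloc.hasFDerivAt_eq_zero (innerSL ℝ q).hasFDerivAt
    have hz0 : ∀ y, inner ℝ q y = 0 := fun y => by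
      simpa using congrArg (fun f => f y) h0
    obtain ⟨y, hy⟩ := frontier_nonempty_of_isBounded hb ⟨z, hzΩ⟩
    rw [hz0 x, ← hz0 y]
    exact h y hy
  · exact (hmax hx).trans (h z ⟨hz, by rwa [ho.interior_eq]⟩)

/-- At a boundary point of a strictly convex domain there is a supporting hyperplane touching the
closure at that point only. -/
lemma exists_strict_support {Ω : Set E} (ho : IsOpen Ω) (hc : Convex ℝ Ω)
    (hs : StrictConvex ℝ (closure Ω)) {y₀ : E} (hy₀ : y₀ ∈ frontier Ω) :
    ∃ N : E, ∀ y ∈ closure Ω, y ≠ y₀ → inner ℝ N y < inner ℝ N y₀ := by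
  have hy₀Ω : y₀ ∉ Ω := fun h => hy₀.2 (by rwa [ho.interior_eq])
  have hne : Ω.Nonempty := closure_nonempty_iff.1 ⟨y₀, hy₀.1⟩
  obtain ⟨f, hf⟩ := geometric_hahn_banach_open_point hc ho hy₀Ω
  have hle : ∀ y ∈ closure Ω, f y ≤ f y₀ := fun y hy =>
    closure_minimal (fun a ha => (hf a ha).le) (isClosed_le f.continuous continuous_const) hy
  refine ⟨(InnerProductSpace.toDual ℝ E).symm f, fun y hy hne' => ?_⟩
  simp only [InnerProductSpace.toDual_symm_apply]
  refine lt_of_le_of_ne (hle y hy) fun heq => ?_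
  have hmid := hs hy hy₀.1 hne' (a := 1 / 2) (b := 1 / 2) (by norm_num) (by norm_num) (by norm_num)
  rw [hc.interior_closure_eq_interior_of_nonempty_interior (by rwa [ho.interior_eq]),
    ho.interior_eq] at hmid
  have := hf _ hmid
  simp only [map_add, map_smul, smul_eq_mul, heq] at this
  linarith

/-- Barriers at a boundary point: boundary data differ from their value at `y₀` by at most `ε` plus
a large multiple of the height below a strictly supporting hyperplane. -/
lemma exists_barrier [Nontrivial E] {Ω : Set E} (ho : IsOpen Ω) (hb : Bornology.IsBounded Ω)
    (hc : Convex ℝ Ω) (hs : StrictConvex ℝ (closure Ω)) {g : E → ℝ}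
    (hg : ContinuousOn g (frontier Ω)) {y₀ : E} (hy₀ : y₀ ∈ frontier Ω) :
    ∃ N : E, N ≠ 0 ∧ ∀ ε > 0, ∃ C₀ : ℝ, ∀ C ≥ C₀, ∀ y ∈ frontier Ω,
      |g y - g y₀| ≤ ε + C * inner ℝ N (y₀ - y) := by
  obtain ⟨N, hN⟩ := exists_strict_support ho hc hs hy₀
  have hcomp := isCompact_frontier_of_isBounded hb
  refine ⟨N, ?_, fun ε hε => ?_⟩
  · rintro rfl
    obtain ⟨x, hx⟩ : Ω.Nonempty := closure_nonempty_iff.1 ⟨y₀, hy₀.1⟩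
    have := hN x (subset_closure hx) (by rintro rfl; exact hy₀.2 (by rwa [ho.interior_eq]))
    simp at this
  obtain ⟨δ, hδ, hgδ⟩ := Metric.continuousOn_iff.1 hg y₀ hy₀ ε hε
  obtain ⟨M, hM⟩ := hcomp.exists_bound_of_continuousOn hg
  have hpos : ∀ y ∈ frontier Ω, 0 ≤ inner ℝ N (y₀ - y) := fun y hy => by
    rcases eq_or_ne y y₀ with rfl | h
    · simp
    · have := hN y hy.1 h
      rw [inner_sub_right]; linarith
  have hfar : ∃ η > 0, ∀ y ∈ frontier Ω, δ ≤ dist y y₀ → η ≤ inner ℝ N (y₀ - y) := by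
    rcases (frontier Ω ∩ {y | δ ≤ dist y y₀}).eq_empty_or_nonempty with he | hne
    · exact ⟨1, one_pos, fun y hy h =>
        absurd (show y ∈ frontier Ω ∩ {y | δ ≤ dist y y₀} from ⟨hy, h⟩) (by simp [he])⟩
    · have hcl : IsClosed {y | δ ≤ dist y y₀} := isClosed_le continuous_const (by fun_prop)
      obtain ⟨z, hz, hmin⟩ := (hcomp.inter_right hcl).exists_isMinOn hne
        (by fun_prop : ContinuousOn (fun y => inner ℝ N (y₀ - y)) _)
      refine ⟨inner ℝ N (y₀ - z), ?_, fun y hy h => hmin ⟨hy, h⟩⟩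
      have hzne : z ≠ y₀ := by
        rintro rfl
        have := hz.2
        simp only [mem_ofPred_eq, dist_self] at this
        linarith
      have := hN z hz.1.1 hzne
      rw [inner_sub_right]; linarith
  obtain ⟨η, hη, hfar⟩ := hfar
  have hM0 : 0 ≤ M := (norm_nonneg _).trans (hM y₀ hy₀)
  refine ⟨2 * M / η, fun C hC y hy => ?_⟩
  have hC0 : 0 ≤ C := le_trans (by positivity) hC
  by_cases hnear : dist y y₀ < δ
  · have h1 := hgδ y hy hnear
    rw [Real.dist_eq] at h1
    have h2 := mul_nonneg hC0 (hpos y hy)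
    linarith
  · have h1 := hfar y hy (not_lt.1 hnear)
    have h2 : 2 * M ≤ C * inner ℝ N (y₀ - y) := by
      calc 2 * M = 2 * M / η * η := by field_simp
        _ ≤ C * inner ℝ N (y₀ - y) := by gcongr
    have h3 := abs_le.1 (hM y hy)
    have h4 := abs_le.1 (hM y₀ hy₀)
    rw [abs_le]
    constructor <;> linarith

end ConvexDomain

/-! ### Decay of integrable Lipschitz functions -/

section Decay

variable {E : Type*} [NormedAddCommGroup E] [MeasurableSpace E] [BorelSpace E]

/-- Outside a large ball, a Lipschitz function whose positive part is integrable is less than `ε`: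
where it is at least `ε`, its positive part contributes a fixed amount to the integral over a ball
of fixed radius. -/
lemma exists_forall_lt_of_lintegral_ne_top (m : Measure E) [m.IsAddHaarMeasure] {F : E → ℝ}
    {D : ℝ≥0} (hF : LipschitzWith D F) (hfin : ∫⁻ p, ENNReal.ofReal (F p) ∂m ≠ ∞) {ε : ℝ}
    (hε : 0 < ε) : ∃ R : ℝ, ∀ p, R < ‖p‖ → F p < ε := by
  set ν := m.withDensity fun p => ENNReal.ofReal (F p) with hν
  have hνs : ∀ s, MeasurableSet s → ν s = ∫⁻ p in s, ENNReal.ofReal (F p) ∂m := fun s hs =>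
    withDensity_apply _ hs
  have hνfin : ν univ ≠ ∞ := by rwa [hνs _ MeasurableSet.univ, setLIntegral_univ]
  -- Within distance `r`, the function changes by at most `ε / 2`.
  set r : ℝ := ε / (2 * (D + 1)) with hr
  have hr0 : 0 < r := by positivity
  have hDr : D * r ≤ ε / 2 := by
    rw [hr]
    calc (D : ℝ) * (ε / (2 * (D + 1))) ≤ (D + 1) * (ε / (2 * (D + 1))) := by gcongr; linarith
      _ = ε / 2 := by field_simp
  have htail : Tendsto (fun k : ℕ => ν (Metric.closedBall 0 k)ᶜ) atTop (𝓝 0) := by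
    have h := tendsto_measure_iInter_atTop (μ := ν)
      (s := fun k : ℕ => (Metric.closedBall (0 : E) k)ᶜ)
      (fun k => Metric.isClosed_closedBall.measurableSet.compl.nullMeasurableSet)
      (fun i j hij => compl_subset_compl.2
        (Metric.closedBall_subset_closedBall (by exact_mod_cast hij)))
      ⟨0, ne_top_of_le_ne_top hνfin (measure_mono (subset_univ _))⟩
    rwa [← compl_iUnion, Metric.iUnion_closedBall_nat, compl_univ, measure_empty] at h
  have hc : 0 < ENNReal.ofReal (ε / 2) * m (Metric.ball 0 r) :=
    ENNReal.mul_pos (by simp [hε]) (Metric.measure_ball_pos m 0 hr0).ne'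
  obtain ⟨k, hk⟩ := (htail.eventually_lt_const hc).exists
  refine ⟨k + r, fun p hp => ?_⟩
  by_contra! hpε
  refine absurd hk (not_lt.2 ?_)
  calc ENNReal.ofReal (ε / 2) * m (Metric.ball 0 r)
      = ∫⁻ _ in Metric.ball p r, ENNReal.ofReal (ε / 2) ∂m := by
        rw [setLIntegral_const, Measure.addHaar_ball_center m p r]
    _ ≤ ∫⁻ q in Metric.ball p r, ENNReal.ofReal (F q) ∂m := by
        refine setLIntegral_mono' Metric.isOpen_ball.measurableSet fun q hq => ?_
        refine ENNReal.ofReal_le_ofReal ?_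
        have h1 := hF.dist_le_mul p q
        have h2 : dist p q ≤ r := by rw [dist_comm]; exact (Metric.mem_ball.1 hq).le
        have h3 : (D : ℝ) * dist p q ≤ D * r := by gcongr
        have h4 := (abs_le.1 (Real.dist_eq (F p) (F q) ▸ h1)).2
        linarith
    _ = ν (Metric.ball p r) := (hνs _ Metric.isOpen_ball.measurableSet).symm
    _ ≤ ν (Metric.closedBall 0 k)ᶜ := by
        refine measure_mono fun q hq hqk => ?_
        rw [mem_closedBall_zero_iff] at hqk
        have h1 : ‖p - q‖ < r := by rw [← dist_eq_norm, dist_comm]; exact hq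
        have h2 := norm_sub_norm_le p q
        linarith

end Decay

/-! ### Boundary values of conjugates -/

section BoundaryValues

variable {E : Type*} [NormedAddCommGroup E] [InnerProductSpace ℝ E] [FiniteDimensional ℝ E]
  [Nontrivial E] {Ω : Set E} {g φ : E → ℝ}

/-- Affine functions lying below the boundary data are bounded on the closure of the domain by any
bound of the data. -/
lemma inner_sub_le_of_conjugateOn_frontier_le (ho : IsOpen Ω) (hb : Bornology.IsBounded Ω)
    (hg : ContinuousOn g (frontier Ω)) (hφ : ∀ p, conjugateOn (frontier Ω) g p ≤ φ p) {M : ℝ}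
    (hM : ∀ y ∈ frontier Ω, g y ≤ M) {x : E} (hx : x ∈ closure Ω) (p : E) :
    inner ℝ x p - φ p ≤ M := by
  have h : inner ℝ p x ≤ φ p + M := inner_le_of_forall_frontier ho hb (fun y hy => by
    have h1 := le_conjugateOn (bddAbove_conjugateOn (isCompact_frontier_of_isBounded hb) hg p) hy
    have h2 := hφ p
    have h3 := hM y hy
    linarith) hx
  rw [real_inner_comm]
  linarith

lemma bddAbove_of_conjugateOn_frontier_le (ho : IsOpen Ω) (hb : Bornology.IsBounded Ω)
    (hg : ContinuousOn g (frontier Ω)) (hφ : ∀ p, conjugateOn (frontier Ω) g p ≤ φ p) {x : E}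
    (hx : x ∈ closure Ω) : BddAbove ((fun p => inner ℝ x p - φ p) '' univ) := by
  obtain ⟨M, hM⟩ := (isCompact_frontier_of_isBounded hb).exists_bound_of_continuousOn hg
  refine ⟨M, ?_⟩
  rintro _ ⟨p, -, rfl⟩
  exact inner_sub_le_of_conjugateOn_frontier_le ho hb hg hφ
    (fun y hy => (le_abs_self _).trans (hM y hy)) hx p

/-- If `φ` lies above the conjugate `H` of the boundary data and `φ - H` is Lipschitz and
integrable, then the conjugate of `φ` is close to `g y₀` near the boundary point `y₀`. The lower
bound comes from the slopes `C • N`, `N` the outer normal of a strictly supporting hyperplane: for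
large `C` they have `φ` close to `H`. -/
lemma exists_abs_conjugateOn_sub_le [MeasurableSpace E] [BorelSpace E] (m : Measure E)
    [m.IsAddHaarMeasure] (ho : IsOpen Ω) (hb : Bornology.IsBounded Ω)
    (hc : Convex ℝ Ω) (hs : StrictConvex ℝ (closure Ω)) (hg : ContinuousOn g (frontier Ω))
    (hφ : ∀ p, conjugateOn (frontier Ω) g p ≤ φ p) {D : ℝ≥0}
    (hL : LipschitzWith D fun p => φ p - conjugateOn (frontier Ω) g p)
    (hfin : ∫⁻ p, ENNReal.ofReal (φ p - conjugateOn (frontier Ω) g p) ∂m ≠ ∞)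
    {y₀ : E} (hy₀ : y₀ ∈ frontier Ω) {ε : ℝ} (hε : 0 < ε) :
    ∃ C : ℝ, ∀ x ∈ closure Ω, |conjugateOn univ φ x - g y₀| ≤ ε + C * ‖x - y₀‖ := by
  obtain ⟨N, hN0, hN⟩ := exists_barrier ho hb hc hs hg hy₀
  obtain ⟨C₀, hC₀⟩ := hN (ε / 2) (half_pos hε)
  obtain ⟨R, hR⟩ := exists_forall_lt_of_lintegral_ne_top m hL hfin (half_pos hε)
  have hN0' : 0 < ‖N‖ := norm_pos_iff.2 hN0
  -- `C` is large enough for the barrier and for the slope `C • N` to have norm more than `R`.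
  set C := max C₀ ((|R| + 1) / ‖N‖) with hC
  have hCN : R < ‖C • N‖ := by
    have h1 : |R| + 1 ≤ C * ‖N‖ := by
      rw [← div_le_iff₀ hN0']; exact le_max_right _ _
    rw [norm_smul, Real.norm_eq_abs]
    have h2 : C * ‖N‖ ≤ |C| * ‖N‖ := by gcongr; exact le_abs_self C
    linarith [le_abs_self R]
  have hbar := hC₀ C (le_max_left _ _)
  have hfr := frontier_nonempty_of_isBounded hb (closure_nonempty_iff.1 ⟨y₀, hy₀.1⟩)
  have hH : conjugateOn (frontier Ω) g (C • N) ≤ inner ℝ (C • N) y₀ - g y₀ + ε / 2 :=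
    conjugateOn_le hfr fun y hy => by
      have h1 := (abs_le.1 (hbar y hy)).1
      rw [inner_sub_right] at h1
      simp only [real_inner_smul_left]
      linarith
  refine ⟨‖C • N‖, fun x hx => abs_le.2 ⟨?_, ?_⟩⟩
  · have h1 := le_conjugateOn (bddAbove_of_conjugateOn_frontier_le ho hb hg hφ hx)
      (mem_univ (C • N))
    have h2 := hR _ hCN
    have h3 : inner ℝ (C • N) (y₀ - x) ≤ ‖C • N‖ * ‖x - y₀‖ := by
      rw [norm_sub_rev]; exact real_inner_le_norm _ _
    rw [inner_sub_right] at h3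
    rw [real_inner_comm] at h1
    linarith
  · have h3 : inner ℝ (C • N) (y₀ - x) ≤ ‖C • N‖ * ‖x - y₀‖ := by
      rw [norm_sub_rev]; exact real_inner_le_norm _ _
    have h4 : conjugateOn univ φ x ≤ g y₀ + ε / 2 + inner ℝ (C • N) (y₀ - x) := by
      refine conjugateOn_le univ_nonempty fun p _ => ?_
      have h5 : inner ℝ (p + C • N) x ≤ φ p + (g y₀ + ε / 2 + inner ℝ (C • N) y₀) :=
        inner_le_of_forall_frontier ho hb (fun y hy => by
          have h1 := le_conjugateOn
            (bddAbove_conjugateOn (isCompact_frontier_of_isBounded hb) hg p) hy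
          have h2 := (abs_le.1 (hbar y hy)).2
          rw [inner_sub_right] at h2
          simp only [inner_add_left, real_inner_smul_left]
          linarith [hφ p]) hx
      rw [inner_add_left] at h5
      rw [inner_sub_right, real_inner_comm]
      linarith
    linarith

/-- Under the same hypotheses the conjugate of `φ` is continuous up to the boundary and attains the
boundary data. -/
lemma continuousOn_conjugateOn_and_eqOn_frontier [MeasurableSpace E] [BorelSpace E] (m : Measure E)
    [m.IsAddHaarMeasure] (ho : IsOpen Ω) (hb : Bornology.IsBounded Ω)
    (hc : Convex ℝ Ω) (hs : StrictConvex ℝ (closure Ω)) (hg : ContinuousOn g (frontier Ω))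
    (hφ : ∀ p, conjugateOn (frontier Ω) g p ≤ φ p) {D : ℝ≥0}
    (hL : LipschitzWith D fun p => φ p - conjugateOn (frontier Ω) g p)
    (hfin : ∫⁻ p, ENNReal.ofReal (φ p - conjugateOn (frontier Ω) g p) ∂m ≠ ∞) :
    ContinuousOn (conjugateOn univ φ) (closure Ω) ∧ EqOn (conjugateOn univ φ) g (frontier Ω) := by
  have heq : EqOn (conjugateOn univ φ) g (frontier Ω) := fun y hy => by
    refine eq_of_abs_sub_nonpos (le_of_forall_pos_le_add fun ε hε => ?_)
    obtain ⟨C, hC⟩ := exists_abs_conjugateOn_sub_le m ho hb hc hs hg hφ hL hfin hy hε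
    simpa using hC y hy.1
  refine ⟨fun x hx => ?_, heq⟩
  by_cases hxΩ : x ∈ Ω
  · have hcv : ConvexOn ℝ Ω (conjugateOn univ φ) := convexOn_conjugateOn univ_nonempty hc
      fun x hx => bddAbove_of_conjugateOn_frontier_le ho hb hg hφ (subset_closure hx)
    exact ((hcv.continuousOn ho).continuousAt (ho.mem_nhds hxΩ)).continuousWithinAt
  · have hxf : x ∈ frontier Ω := ⟨hx, by rwa [ho.interior_eq]⟩
    rw [ContinuousWithinAt, Metric.tendsto_nhds]
    intro ε hε
    obtain ⟨C, hC⟩ := exists_abs_conjugateOn_sub_le m ho hb hc hs hg hφ hL hfin hxf (half_pos hε)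
    have hlim : Tendsto (fun z => ε / 2 + C * ‖z - x‖) (𝓝[closure Ω] x) (𝓝 (ε / 2)) := by
      have : Continuous fun z => ε / 2 + C * ‖z - x‖ := by fun_prop
      simpa using (this.tendsto x).mono_left nhdsWithin_le_nhds
    filter_upwards [hlim.eventually_lt_const (half_lt_self hε), self_mem_nhdsWithin] with z hz hzK
    rw [heq hxf, Real.dist_eq]
    exact (hC z hzK).trans_lt hz

end BoundaryValues

/-! ### Pointwise compactness of Lipschitz functions -/

section Compactness

variable {E : Type*} [NormedAddCommGroup E] [NormedSpace ℝ E] [FiniteDimensional ℝ E]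

/-- A sequence of `D`-Lipschitz functions between two fixed functions has a pointwise convergent
subsequence. -/
lemma exists_subseq_tendsto_of_lipschitzWith {D : ℝ≥0} {φ : ℕ → E → ℝ}
    (hL : ∀ k, LipschitzWith D (φ k)) {a b : E → ℝ} (hφ : ∀ k p, φ k p ∈ Icc (a p) (b p)) :
    ∃ (ψ : E → ℝ) (s : ℕ → ℕ), StrictMono s ∧ LipschitzWith D ψ ∧
      ∀ p, Tendsto (fun k => φ (s k) p) atTop (𝓝 (ψ p)) := by
  let S : Set C(E, ℝ) := {f | LipschitzWith D f ∧ ∀ p, f p ∈ Icc (a p) (b p)}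
  have hS1 : IsCompact (ContinuousMap.toFun '' S) := by
    have himage : ContinuousMap.toFun '' S =
        {f : E → ℝ | LipschitzWith D f} ∩ univ.pi fun p => Icc (a p) (b p) := by
      ext f
      constructor
      · rintro ⟨f, hf, rfl⟩
        exact ⟨hf.1, fun p _ => hf.2 p⟩
      · rintro ⟨h1, h2⟩
        exact ⟨⟨f, h1.continuous⟩, ⟨h1, fun p => h2 p (mem_univ p)⟩, rfl⟩
    rw [himage, inter_comm]
    refine (isCompact_univ_pi fun p => isCompact_Icc).inter_right ?_
    have : {f : E → ℝ | LipschitzWith D f} =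
        ⋂ (p : E) (q : E), {f : E → ℝ | dist (f p) (f q) ≤ D * dist p q} := by
      ext f
      simp [lipschitzWith_iff_dist_le_mul]
    rw [this]
    refine isClosed_iInter fun p => isClosed_iInter fun q => isClosed_le ?_ continuous_const
    exact (continuous_apply p).dist (continuous_apply q)
  have hS2 : Equicontinuous ((↑) : S → E → ℝ) :=
    (LipschitzWith.uniformEquicontinuous _ D fun f : S => f.2.1).equicontinuous
  obtain ⟨f, hf, s, hs, hlim⟩ := (ArzelaAscoli.isCompact_of_equicontinuous S hS1 hS2).tendsto_subseq
    (x := fun k => ⟨φ k, (hL k).continuous⟩) (fun k => ⟨hL k, hφ k⟩)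
  exact ⟨f, s, hs, hf.1, fun p => ((continuous_eval_const p).tendsto f).comp hlim⟩

end Compactness

/-! ### Existence of a minimiser of the energy -/

section Energy

lemma liminf_add_liminf_le (a b : ℕ → ℝ≥0∞) :
    liminf a atTop + liminf b atTop ≤ liminf (fun k => a k + b k) atTop := by
  simp only [liminf_eq_iSup_iInf_of_nat]
  rw [ENNReal.iSup_add_iSup_of_monotone]
  · exact iSup_mono fun k => le_iInf₂ fun i hi => add_le_add (iInf₂_le i hi) (iInf₂_le i hi)
  · exact fun i j hij => le_iInf₂ fun k hk => iInf₂_le k (hij.trans hk)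
  · exact fun i j hij => le_iInf₂ fun k hk => iInf₂_le k (hij.trans hk)

lemma measurable_iSup_ofReal_inner_sub {E : Type*} [NormedAddCommGroup E] [InnerProductSpace ℝ E]
    [MeasurableSpace E] [BorelSpace E] (φ : E → ℝ) (T : ℝ) :
    Measurable fun x : E => ⨆ p, ENNReal.ofReal (inner ℝ x p - φ p + T) := by
  refine LowerSemicontinuous.measurable (lowerSemicontinuous_iSup fun p => ?_)
  exact (ENNReal.continuous_ofReal.comp (by fun_prop)).lowerSemicontinuous

variable {E : Type*} [NormedAddCommGroup E] [InnerProductSpace ℝ E] [MeasurableSpace E]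
  [BorelSpace E]

/-- The functional minimised by the conjugate `φ` of the solution: `∫ (φ - H) dm + ∫_Ω (u + T) dμ`,
where `H` is the conjugate of the boundary data and `u x = sup_p (x · p - φ p)`. The shift `T` makes
the second integrand nonnegative when `φ 0 ≤ T`, and truncating it under the supremum makes it a
lower semicontinuous function on the whole space. -/
noncomputable def dualEnergy (m μ : Measure E) (Ω : Set E) (g : E → ℝ) (T : ℝ) (φ : E → ℝ) : ℝ≥0∞ :=
  ∫⁻ p, ENNReal.ofReal (φ p - conjugateOn (frontier Ω) g p) ∂m +
    ∫⁻ x in Ω, ⨆ p, ENNReal.ofReal (inner ℝ x p - φ p + T) ∂μ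

/-- The functions among which the energy is minimised: `D`-Lipschitz, above the conjugate of the
boundary data, and at most `T` at the origin. -/
def admissibleSet (Ω : Set E) (g : E → ℝ) (D : ℝ≥0) (T : ℝ) : Set (E → ℝ) :=
  {φ | LipschitzWith D φ ∧ (∀ p, conjugateOn (frontier Ω) g p ≤ φ p) ∧ φ 0 ≤ T}

/-- Lower semicontinuity of the energy under pointwise convergence, by Fatou's lemma for both
integrals. -/
lemma dualEnergy_le_liminf (m μ : Measure E) {Ω : Set E} {g : E → ℝ} {T : ℝ} {φ : ℕ → E → ℝ}
    {ψ : E → ℝ} (hH : Measurable (conjugateOn (frontier Ω) g)) (hφ : ∀ k, Measurable (φ k))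
    (hlim : ∀ p, Tendsto (fun k => φ k p) atTop (𝓝 (ψ p))) :
    dualEnergy m μ Ω g T ψ ≤ liminf (fun k => dualEnergy m μ Ω g T (φ k)) atTop := by
  have h1 : ∫⁻ p, ENNReal.ofReal (ψ p - conjugateOn (frontier Ω) g p) ∂m ≤
      liminf (fun k => ∫⁻ p, ENNReal.ofReal (φ k p - conjugateOn (frontier Ω) g p) ∂m) atTop := by
    refine le_trans (lintegral_mono fun p => ?_)
      (lintegral_liminf_le fun k => ((hφ k).sub hH).ennreal_ofReal)
    exact (ENNReal.tendsto_ofReal ((hlim p).sub_const _)).liminf_eq.ge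
  have h2 : ∫⁻ x in Ω, ⨆ p, ENNReal.ofReal (inner ℝ x p - ψ p + T) ∂μ ≤
      liminf (fun k => ∫⁻ x in Ω, ⨆ p, ENNReal.ofReal (inner ℝ x p - φ k p + T) ∂μ) atTop := by
    refine le_trans (lintegral_mono fun x => iSup_le fun p => ?_)
      (lintegral_liminf_le fun k => measurable_iSup_ofReal_inner_sub (φ k) T)
    rw [← (ENNReal.tendsto_ofReal (((hlim p).const_sub (inner ℝ x p)).add_const T)).liminf_eq]
    exact liminf_le_liminf (Eventually.of_forall fun k =>
      le_iSup (fun p => ENNReal.ofReal (inner ℝ x p - φ k p + T)) p)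
  exact (add_le_add h1 h2).trans (liminf_add_liminf_le _ _)

variable [FiniteDimensional ℝ E]

/-- The energy attains its minimum on the admissible set. -/
lemma exists_isMinOn_dualEnergy (m μ : Measure E) {Ω : Set E} {g : E → ℝ} {D : ℝ≥0} {T : ℝ}
    (hH : Measurable (conjugateOn (frontier Ω) g)) (hne : (admissibleSet Ω g D T).Nonempty) :
    ∃ φ ∈ admissibleSet Ω g D T, IsMinOn (dualEnergy m μ Ω g T) (admissibleSet Ω g D T) φ := by
  obtain ⟨J, -, hJ, hmem⟩ := exists_seq_tendsto_sInf (hne.image (dualEnergy m μ Ω g T))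
    (OrderBot.bddBelow _)
  choose φ hφ hφJ using hmem
  obtain ⟨ψ, s, hs, hψL, hlim⟩ := exists_subseq_tendsto_of_lipschitzWith (D := D) (φ := φ)
    (fun k => (hφ k).1) (a := conjugateOn (frontier Ω) g) (b := fun p => T + D * ‖p‖)
    (fun k p => ⟨(hφ k).2.1 p, by
      have h1 := (hφ k).1.dist_le_mul p 0
      rw [dist_zero_right, Real.dist_eq] at h1
      have := (abs_le.1 h1).2
      linarith [(hφ k).2.2]⟩)
  refine ⟨ψ, ⟨hψL, fun p => ge_of_tendsto' (hlim p) fun k => (hφ _).2.1 p,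
    le_of_tendsto' (hlim 0) fun k => (hφ _).2.2⟩, fun χ hχ => ?_⟩
  have h1 := dualEnergy_le_liminf m μ (T := T) hH (fun k => (hφ (s k)).1.continuous.measurable) hlim
  simp only [hφJ] at h1
  exact (h1.trans_eq (hJ.comp hs.tendsto_atTop).liminf_eq).trans (sInf_le (mem_image_of_mem _ hχ))

/-- Coercivity: if `T` is large, a minimiser of the energy does not meet the constraint `φ 0 ≤ T`.
Indeed `φ 0 > T - 1` would make `φ - H` of size `T` on a ball of volume more than `μ Ω`, while the
energy of `H` is at most about `T * μ Ω`. -/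
lemma exists_minimizer_lt [Nontrivial E] (m μ : Measure E) [m.IsAddHaarMeasure] {Ω : Set E}
    (ho : IsOpen Ω) (hb : Bornology.IsBounded Ω) (hne : Ω.Nonempty) (hμ : μ Ω < ∞) {g : E → ℝ}
    (hg : ContinuousOn g (frontier Ω)) {D : ℝ≥0} (hD : ∀ x ∈ closure Ω, ‖x‖ ≤ D) :
    ∃ (T : ℝ) (φ : E → ℝ), φ ∈ admissibleSet Ω g D T ∧ φ 0 ≤ T - 1 ∧
      dualEnergy m μ Ω g T φ ≠ ∞ ∧
      IsMinOn (dualEnergy m μ Ω g T) (admissibleSet Ω g D T) φ := by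
  set H := conjugateOn (frontier Ω) g with hHdef
  have hHL : LipschitzWith D H := lipschitzWith_conjugateOn (isCompact_frontier_of_isBounded hb)
    (frontier_nonempty_of_isBounded hb hne) hg fun x hx => hD x hx.1
  obtain ⟨M, hM⟩ := (isCompact_frontier_of_isBounded hb).exists_bound_of_continuousOn hg
  have hM0 : 0 ≤ M := by
    obtain ⟨y, hy⟩ := frontier_nonempty_of_isBounded hb hne
    exact (norm_nonneg _).trans (hM y hy)
  set a := (μ Ω).toReal with ha
  have ha0 : 0 ≤ a := ENNReal.toReal_nonneg
  obtain ⟨R, hR⟩ : ∃ R : ℕ, ENNReal.ofReal (a + 1) < m (Metric.ball 0 R) := by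
    have h := tendsto_measure_iUnion_atTop (μ := m) (s := fun k : ℕ => Metric.ball (0 : E) k)
      (fun i j hij => Metric.ball_subset_ball (by exact_mod_cast hij))
    rw [Metric.iUnion_ball_nat, measure_univ_of_isAddLeftInvariant] at h
    exact (h.eventually_const_lt ENNReal.ofReal_lt_top).exists
  -- If `φ 0 > T - 1`, then `φ - H ≥ T - c` on the ball of radius `R`; `T` is chosen so that
  -- `(T - c) * (a + 1)` exceeds the bound `(M + T) * a` for the energy of `H`.
  set c := |1 + H 0 + 2 * D * R| with hc
  set T := M * a + c * (a + 1) + 1 + |H 0| with hT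
  have hT0 : 0 ≤ T := by positivity
  have hHmem : H ∈ admissibleSet Ω g D T := ⟨hHL, fun p => le_rfl, by
    have : 0 ≤ M * a + c * (a + 1) + 1 := by positivity
    linarith [le_abs_self (H 0)]⟩
  have hHE : dualEnergy m μ Ω g T H ≤ ENNReal.ofReal ((M + T) * a) := by
    have h1 : ∫⁻ x in Ω, ⨆ p, ENNReal.ofReal (inner ℝ x p - H p + T) ∂μ ≤
        ∫⁻ _ in Ω, ENNReal.ofReal (M + T) ∂μ := by
      refine setLIntegral_mono' ho.measurableSet fun x hx => iSup_le fun p => ?_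
      refine ENNReal.ofReal_le_ofReal ?_
      have := inner_sub_le_of_conjugateOn_frontier_le ho hb hg (φ := H) (fun p => le_rfl)
        (fun y hy => (le_abs_self _).trans (hM y hy)) (subset_closure hx) p
      linarith
    rw [setLIntegral_const] at h1
    simp only [dualEnergy, ← hHdef, sub_self, ENNReal.ofReal_zero, lintegral_zero, zero_add]
    rwa [ENNReal.ofReal_mul (by positivity), ha, ENNReal.ofReal_toReal hμ.ne]
  obtain ⟨φ, hφ, hmin⟩ := exists_isMinOn_dualEnergy m μ hHL.continuous.measurable ⟨H, hHmem⟩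
  have hφE : dualEnergy m μ Ω g T φ ≤ ENNReal.ofReal ((M + T) * a) := (hmin hHmem).trans hHE
  refine ⟨T, φ, hφ, ?_, ne_top_of_le_ne_top ENNReal.ofReal_ne_top hφE, hmin⟩
  by_contra! hlt
  refine absurd hφE (not_le.2 ?_)
  have hTc : 0 ≤ T - c := by
    have : 0 ≤ M * a + c * a + 1 + |H 0| := by positivity
    linarith
  calc ENNReal.ofReal ((M + T) * a) < ENNReal.ofReal ((T - c) * (a + 1)) := by
        have h1 : (M + T) * a < (T - c) * (a + 1) := by
          have : M * a + c * (a + 1) < T := by linarith [abs_nonneg (H 0)]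
          linarith
        exact (ENNReal.ofReal_lt_ofReal_iff_of_nonneg (by positivity)).2 h1
    _ = ENNReal.ofReal (T - c) * ENNReal.ofReal (a + 1) := ENNReal.ofReal_mul hTc
    _ ≤ ENNReal.ofReal (T - c) * m (Metric.ball 0 R) := by gcongr
    _ = ∫⁻ _ in Metric.ball 0 (R : ℝ), ENNReal.ofReal (T - c) ∂m := (setLIntegral_const _ _).symm
    _ ≤ ∫⁻ p in Metric.ball 0 (R : ℝ), ENNReal.ofReal (φ p - H p) ∂m := by
        refine setLIntegral_mono' Metric.isOpen_ball.measurableSet fun p hp => ?_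
        refine ENNReal.ofReal_le_ofReal ?_
        rw [mem_ball_zero_iff] at hp
        have h1 := hφ.1.dist_le_mul p 0
        have h2 := hHL.dist_le_mul p 0
        rw [dist_zero_right, Real.dist_eq] at h1 h2
        have h3 := (abs_le.1 h1).1
        have h4 := (abs_le.1 h2).2
        have h5 : (D : ℝ) * ‖p‖ ≤ D * R := by gcongr
        linarith [le_abs_self (1 + H 0 + 2 * D * R)]
    _ ≤ ∫⁻ p, ENNReal.ofReal (φ p - H p) ∂m := setLIntegral_le_lintegral _ _
    _ ≤ dualEnergy m μ Ω g T φ := le_self_add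

end Energy

/-! ### First variation of the conjugate -/

section Perturbation

variable {E : Type*} [NormedAddCommGroup E] [InnerProductSpace ℝ E]

lemma conjugateOn_le_add_of_abs_sub_le {S : Set E} (hS : IsCompact S) (hne : S.Nonempty)
    {w w' : E → ℝ} (hw : ContinuousOn w S) {c : ℝ} (h : ∀ x ∈ S, |w x - w' x| ≤ c) (p : E) :
    conjugateOn S w' p ≤ conjugateOn S w p + c :=
  conjugateOn_le hne fun x hx => by
    have h1 := le_conjugateOn (bddAbove_conjugateOn hS hw p) hx
    have h2 := (abs_le.1 (h x hx)).2
    linarith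

/-- If the conjugate of a bounded function `w` at the slope `p` is attained at a point of `L`, and
`S` contains the `r`-neighbourhood of `L`, then moving by `r` in the direction `p` bounds `‖p‖`. -/
lemma norm_mul_le_of_conjugateOn_eq {S L : Set E} {w : E → ℝ} {p a : E} {r M : ℝ} (hr : 0 < r)
    (hLS : Metric.cthickening r L ⊆ S) (hb : BddAbove ((fun x => inner ℝ p x - w x) '' S))
    (hM : ∀ x ∈ S, |w x| ≤ M) (ha : a ∈ L) (heq : conjugateOn S w p = inner ℝ p a - w a) :
    ‖p‖ * r ≤ 2 * M := by
  have haS : a ∈ S := hLS (Metric.self_subset_cthickening L ha)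
  have hM0 : 0 ≤ M := (abs_nonneg _).trans (hM a haS)
  rcases eq_or_ne p 0 with rfl | hp
  · simpa using hM0
  have hp' : ‖p‖ ≠ 0 := norm_ne_zero_iff.2 hp
  have hy : a + (r / ‖p‖) • p ∈ S := hLS (Metric.mem_cthickening_of_dist_le _ a r L ha (by
    rw [dist_self_add_left, norm_smul, norm_div, norm_norm, Real.norm_of_nonneg hr.le]
    field_simp
    exact le_rfl))
  have h1 := le_conjugateOn hb hy
  have h2 := (abs_le.1 (hM _ hy)).2
  have h3 := (abs_le.1 (hM a haS)).1
  have h4 : inner ℝ p (a + (r / ‖p‖) • p) = inner ℝ p a + ‖p‖ * r := by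
    rw [inner_add_right, real_inner_smul_right, real_inner_self_eq_norm_sq]
    field_simp
  linarith

/-- Perturbing `w` on a set compactly contained in `S` changes its conjugate only for a bounded set
of slopes, uniformly for perturbations of bounded size. -/
lemma exists_forall_conjugateOn_add_eq {S L : Set E} (hS : IsCompact S) (hne : S.Nonempty)
    {r : ℝ} (hr : 0 < r) (hLS : Metric.cthickening r L ⊆ S) {w f : E → ℝ} (hw : ContinuousOn w S)
    (hf : Continuous f) (hfL : ∀ x ∉ L, f x = 0) :
    ∃ R : ℝ, ∀ p, R < ‖p‖ → ∀ t ∈ Icc (0 : ℝ) 1,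
      conjugateOn S (fun x => w x + t * f x) p = conjugateOn S w p := by
  obtain ⟨M₁, hM₁⟩ := hS.exists_bound_of_continuousOn hw
  obtain ⟨M₂, hM₂⟩ := hS.exists_bound_of_continuousOn hf.continuousOn
  have hwt : ∀ t : ℝ, ContinuousOn (fun x => w x + t * f x) S := fun t =>
    hw.add (by fun_prop)
  have key : ∀ t ∈ Icc (0 : ℝ) 1, ∀ p, 2 * (M₁ + M₂) / r < ‖p‖ → ∀ a ∈ S,
      conjugateOn S (fun x => w x + t * f x) p = inner ℝ p a - (w a + t * f a) → f a = 0 := by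
    intro t ht p hp a _ heq
    by_contra hfa
    have haL : a ∈ L := by_contra fun h => hfa (hfL a h)
    have h1 := norm_mul_le_of_conjugateOn_eq (M := M₁ + M₂) hr hLS
      (bddAbove_conjugateOn hS (hwt t) p) (fun x hx => ?_) haL heq
    · rw [div_lt_iff₀ hr] at hp
      linarith
    · calc |w x + t * f x| ≤ |w x| + |t * f x| := abs_add_le _ _
        _ = |w x| + t * |f x| := by rw [abs_mul, abs_of_nonneg ht.1]
        _ ≤ M₁ + 1 * M₂ := by
            gcongr
            exacts [hM₁ x hx, ht.2, hM₂ x hx]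
        _ = M₁ + M₂ := by ring
  refine ⟨2 * (M₁ + M₂) / r, fun p hp t ht => le_antisymm ?_ ?_⟩
  · obtain ⟨a, ha, heq⟩ := exists_conjugateOn_eq hS hne (hwt t) p
    have hfa := key t ht p hp a ha heq
    rw [heq, hfa, mul_zero, add_zero]
    exact le_conjugateOn (bddAbove_conjugateOn hS hw p) ha
  · obtain ⟨a, ha, heq⟩ := exists_conjugateOn_eq hS hne hw p
    have h1 := le_conjugateOn (bddAbove_conjugateOn hS (hwt t) p) ha
    rw [key 0 ⟨le_rfl, zero_le_one⟩ p hp a ha (by simpa using heq), mul_zero, add_zero] at h1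
    rw [heq]
    exact h1

/-- The derivative of the conjugate under the perturbation `w + t f`, at a slope where the conjugate
of `w` is differentiable: the maximisers of the perturbed problems converge to the gradient. -/
lemma tendsto_conjugateOn_add_sub_div [CompleteSpace E] {S : Set E} (hS : IsCompact S)
    (hne : S.Nonempty) {w f : E → ℝ} (hw : ContinuousOn w S) (hf : Continuous f) {p : E}
    (hd : DifferentiableAt ℝ (conjugateOn S w) p) {t : ℕ → ℝ} (ht0 : ∀ k, 0 < t k)
    (ht : Tendsto t atTop (𝓝 0)) :
    Tendsto (fun k => (conjugateOn S (fun x => w x + t k * f x) p - conjugateOn S w p) / t k) atTop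
      (𝓝 (-f (gradient (conjugateOn S w) p))) := by
  have hwt : ∀ s : ℝ, ContinuousOn (fun x => w x + s * f x) S := fun s => hw.add (by fun_prop)
  choose a haS ha using fun k => exists_conjugateOn_eq hS hne (hwt (t k)) p
  obtain ⟨a₀, ha₀S, ha₀⟩ := exists_conjugateOn_eq hS hne hw p
  rw [eq_gradient_of_conjugateOn_eq hS hw ha₀S ha₀ hd]
  obtain ⟨M, hM⟩ := hS.exists_bound_of_continuousOn hf.continuousOn
  have hlow : ∀ k, -f a₀ * t k ≤ conjugateOn S (fun x => w x + t k * f x) p - conjugateOn S w p :=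
    fun k => by
      have := le_conjugateOn (bddAbove_conjugateOn hS (hwt (t k)) p) ha₀S
      rw [ha₀]
      linarith
  have hup : ∀ k, conjugateOn S (fun x => w x + t k * f x) p - conjugateOn S w p ≤ -f (a k) * t k :=
    fun k => by
      have := le_conjugateOn (bddAbove_conjugateOn hS hw p) (haS k)
      rw [ha k]
      linarith
  -- A cluster point of the maximisers `a k` is a maximiser for `w`, hence equal to `a₀`.
  have hlim : Tendsto a atTop (𝓝 a₀) := by
    refine hS.tendsto_nhds_of_unique_mapClusterPt (Eventually.of_forall haS) fun x hx hcl => ?_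
    obtain ⟨s, hs, hsx⟩ := MapClusterPt.tendsto_subseq hcl
    have h1 : Tendsto (fun k => inner ℝ p (a (s k)) - w (a (s k))) atTop
        (𝓝 (inner ℝ p x - w x)) := by
      have hc : ContinuousOn (fun x => inner ℝ p x - w x) S :=
        (by fun_prop : ContinuousOn (fun x => inner ℝ p x) S).sub hw
      exact (hc x hx).tendsto.comp
        (tendsto_nhdsWithin_iff.2 ⟨hsx, Eventually.of_forall fun k => haS _⟩)
    have h2 : Tendsto (fun k => conjugateOn S w p - 2 * M * t (s k)) atTop
        (𝓝 (conjugateOn S w p)) := by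
      simpa using (ht.comp hs.tendsto_atTop).const_mul (2 * M) |>.const_sub (conjugateOn S w p)
    have h3 : conjugateOn S w p ≤ inner ℝ p x - w x := by
      refine le_of_tendsto_of_tendsto' h2 h1 fun k => ?_
      have h4 := hlow (s k)
      rw [ha (s k)] at h4
      have h5 := (abs_le.1 (hM a₀ ha₀S)).2
      have h6 := (abs_le.1 (hM _ (haS (s k)))).1
      have h7 := mul_le_mul_of_nonneg_right h5 (ht0 (s k)).le
      have h8 := mul_le_mul_of_nonneg_right h6 (ht0 (s k)).le
      linarith
    have h4 := le_antisymm h3 (le_conjugateOn (bddAbove_conjugateOn hS hw p) hx)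
    rw [← eq_gradient_of_conjugateOn_eq hS hw hx h4 hd,
      eq_gradient_of_conjugateOn_eq hS hw ha₀S ha₀ hd]
  refine tendsto_of_tendsto_of_tendsto_of_le_of_le tendsto_const_nhds
    ((hf.tendsto a₀).comp hlim).neg (fun k => ?_) (fun k => ?_)
  · rw [le_div_iff₀ (ht0 k)]; exact hlow k
  · rw [div_le_iff₀ (ht0 k)]; exact hup k

end Perturbation

lemma measurable_gradient {E : Type*} [NormedAddCommGroup E] [InnerProductSpace ℝ E]
    [FiniteDimensional ℝ E] [MeasurableSpace E] [BorelSpace E] (φ : E → ℝ) :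
    Measurable (gradient φ) := by
  borelize (StrongDual ℝ E)
  exact (InnerProductSpace.toDual ℝ E).symm.continuous.measurable.comp (measurable_fderiv ℝ φ)

/-! ### The Euler–Lagrange equation -/

section EulerLagrange

variable {E : Type*} [NormedAddCommGroup E] [InnerProductSpace ℝ E] [FiniteDimensional ℝ E]
  [MeasurableSpace E] [BorelSpace E] [Nontrivial E] {m μ : Measure E}
  {Ω : Set E} {g φ : E → ℝ} {D : ℝ≥0} {T : ℝ}

/-- Minimality, tested with the conjugate of `u + f`, `u` the conjugate of the minimiser. Replacing
the minimiser by the conjugate of `u` lowers its energy. -/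
lemma lintegral_add_le_of_isMinOn (ho : IsOpen Ω) (hb : Bornology.IsBounded Ω) (hne : Ω.Nonempty)
    (hg : ContinuousOn g (frontier Ω)) (hD : ∀ x ∈ closure Ω, ‖x‖ ≤ D)
    (hφ : φ ∈ admissibleSet Ω g D T) (hφT : φ 0 ≤ T - 1)
    (hmin : IsMinOn (dualEnergy m μ Ω g T) (admissibleSet Ω g D T) φ)
    (huc : ContinuousOn (conjugateOn univ φ) (closure Ω))
    (hug : EqOn (conjugateOn univ φ) g (frontier Ω)) {f : E → ℝ} (hf : Continuous f)
    (hf0 : ∀ x ∈ frontier Ω, f x = 0) (hf1 : ∀ x, |f x| ≤ 1) :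
    ∫⁻ p, ENNReal.ofReal (conjugateOn (closure Ω) (conjugateOn univ φ) p -
          conjugateOn (frontier Ω) g p) ∂m +
        ∫⁻ x in Ω, ENNReal.ofReal (conjugateOn univ φ x + T) ∂μ ≤ dualEnergy m μ Ω g T φ ∧
    dualEnergy m μ Ω g T φ ≤
      ∫⁻ p, ENNReal.ofReal (conjugateOn (closure Ω) (fun x => conjugateOn univ φ x + f x) p -
          conjugateOn (frontier Ω) g p) ∂m +
        ∫⁻ x in Ω, ENNReal.ofReal (conjugateOn univ φ x + f x + T) ∂μ := by
  set u := conjugateOn univ φ with hu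
  have hK := hb.isCompact_closure
  have hfr := frontier_nonempty_of_isBounded hb hne
  have hbdd : ∀ x ∈ closure Ω, BddAbove ((fun p => inner ℝ x p - φ p) '' univ) := fun x hx =>
    bddAbove_of_conjugateOn_frontier_le ho hb hg hφ.2.1 hx
  have huf : ContinuousOn (fun x => u x + f x) (closure Ω) := huc.add hf.continuousOn
  constructor
  · refine add_le_add (lintegral_mono fun p => ENNReal.ofReal_le_ofReal ?_)
      (setLIntegral_mono' ho.measurableSet fun x hx => ?_)
    · refine sub_le_sub_right (conjugateOn_le hne.closure fun x hx => ?_) _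
      have := le_conjugateOn (hbdd x hx) (mem_univ p)
      rw [real_inner_comm]
      linarith
    · set s := ⨆ p, ENNReal.ofReal (inner ℝ x p - φ p + T) with hs
      rcases eq_or_ne s ∞ with htop | htop
      · rw [htop]; exact le_top
      rw [ENNReal.ofReal_le_iff_le_toReal htop]
      have : u x ≤ s.toReal - T := conjugateOn_le univ_nonempty fun p _ => by
        have h1 : ENNReal.ofReal (inner ℝ x p - φ p + T) ≤ s :=
          le_iSup (fun p => ENNReal.ofReal (inner ℝ x p - φ p + T)) p
        rw [ENNReal.ofReal_le_iff_le_toReal htop] at h1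
        linarith
      linarith
  · have hmem : conjugateOn (closure Ω) (fun x => u x + f x) ∈ admissibleSet Ω g D T := by
      refine ⟨lipschitzWith_conjugateOn hK hne.closure huf hD, fun p => ?_, ?_⟩
      · refine conjugateOn_le hfr fun y hy => ?_
        have := le_conjugateOn (bddAbove_conjugateOn hK huf p) hy.1
        rwa [hf0 y hy, add_zero, hug hy] at this
      · refine conjugateOn_le hne.closure fun x hx => ?_
        have h1 := le_conjugateOn (hbdd x hx) (mem_univ 0)
        have h2 := (abs_le.1 (hf1 x)).1
        simp only [inner_zero_right, inner_zero_left] at h1 ⊢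
        linarith
    refine (hmin hmem).trans (add_le_add le_rfl
      (setLIntegral_mono' ho.measurableSet fun x hx => iSup_le fun p => ?_))
    refine ENNReal.ofReal_le_ofReal ?_
    have := le_conjugateOn (bddAbove_conjugateOn hK huf p) (subset_closure hx)
    rw [real_inner_comm]
    linarith

/-- The inequality of `lintegral_add_le_of_isMinOn` as one between real integrals. -/
lemma integral_conjugateOn_sub_add_nonneg (ho : IsOpen Ω) (hb : Bornology.IsBounded Ω)
    (hne : Ω.Nonempty) (hμ : μ Ω < ∞) (hg : ContinuousOn g (frontier Ω))
    (hD : ∀ x ∈ closure Ω, ‖x‖ ≤ D) (hφ : φ ∈ admissibleSet Ω g D T) (hφT : φ 0 ≤ T - 1)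
    (hE : dualEnergy m μ Ω g T φ ≠ ∞)
    (hmin : IsMinOn (dualEnergy m μ Ω g T) (admissibleSet Ω g D T) φ)
    (huc : ContinuousOn (conjugateOn univ φ) (closure Ω))
    (hug : EqOn (conjugateOn univ φ) g (frontier Ω)) {f : E → ℝ} (hf : Continuous f)
    (hf0 : ∀ x ∈ frontier Ω, f x = 0) (hf1 : ∀ x, |f x| ≤ 1)
    (hint : Integrable (fun p => conjugateOn (closure Ω) (fun x => conjugateOn univ φ x + f x) p -
      conjugateOn (closure Ω) (conjugateOn univ φ) p) m) :
    0 ≤ ∫ p, (conjugateOn (closure Ω) (fun x => conjugateOn univ φ x + f x) p -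
      conjugateOn (closure Ω) (conjugateOn univ φ) p) ∂m + ∫ x in Ω, f x ∂μ := by
  obtain ⟨hle₁, hle₂⟩ := lintegral_add_le_of_isMinOn ho hb hne hg hD hφ hφT hmin huc hug hf hf0 hf1
  set u := conjugateOn univ φ with hu
  set H := conjugateOn (frontier Ω) g with hH
  set φ₀ := conjugateOn (closure Ω) u with hφ₀
  set φ₁ := conjugateOn (closure Ω) (fun x => u x + f x) with hφ₁
  have hK := hb.isCompact_closure
  have hfr := frontier_nonempty_of_isBounded hb hne
  have hbdd : ∀ x ∈ closure Ω, BddAbove ((fun p => inner ℝ x p - φ p) '' univ) := fun x hx =>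
    bddAbove_of_conjugateOn_frontier_le ho hb hg hφ.2.1 hx
  have huf : ContinuousOn (fun x => u x + f x) (closure Ω) := huc.add hf.continuousOn
  have hHφ₀ : ∀ p, 0 ≤ φ₀ p - H p := fun p => by
    refine sub_nonneg.2 (conjugateOn_le hfr fun y hy => ?_)
    have := le_conjugateOn (bddAbove_conjugateOn hK huc p) hy.1
    rwa [hug hy] at this
  have hHφ₁ : ∀ p, 0 ≤ φ₁ p - H p := fun p => by
    refine sub_nonneg.2 (conjugateOn_le hfr fun y hy => ?_)
    have := le_conjugateOn (bddAbove_conjugateOn hK huf p) hy.1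
    rwa [hf0 y hy, add_zero, hug hy] at this
  have huT : ∀ x ∈ closure Ω, 1 ≤ u x + T := fun x hx => by
    have h1 := le_conjugateOn (hbdd x hx) (mem_univ 0)
    simp only [inner_zero_right] at h1
    linarith
  have hcontH : Continuous H := (lipschitzWith_conjugateOn (isCompact_frontier_of_isBounded hb) hfr
    hg fun x hx => hD x hx.1).continuous
  have hcont₀ : Continuous φ₀ := (lipschitzWith_conjugateOn hK hne.closure huc hD).continuous
  have hX : Integrable (fun p => φ₀ p - H p) m := by
    refine (lintegral_ofReal_ne_top_iff_integrable (hcont₀.sub hcontH).aestronglyMeasurable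
      (Eventually.of_forall hHφ₀)).1 ?_
    exact ne_top_of_le_ne_top hE (le_self_add.trans hle₁)
  have hY : Integrable (fun p => φ₁ p - H p) m := by
    refine (hX.add hint).congr (Eventually.of_forall fun p => ?_)
    simp only [Pi.add_apply]
    ring
  have hbound : ∀ {h : E → ℝ}, ContinuousOn h (closure Ω) → IntegrableOn h Ω μ := fun {h} hc => by
    obtain ⟨M, hM⟩ := hK.exists_bound_of_continuousOn hc
    have : Fact (μ Ω < ∞) := ⟨hμ⟩
    refine Integrable.of_bound
      ((hc.mono subset_closure).aestronglyMeasurable ho.measurableSet) M ?_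
    filter_upwards [ae_restrict_mem ho.measurableSet] with x hx using hM x (subset_closure hx)
  have hU : IntegrableOn (fun x => u x + T) Ω μ := hbound (huc.add (continuousOn_const (c := T)))
  have hF : IntegrableOn f Ω μ := hbound hf.continuousOn
  have hUF : IntegrableOn (fun x => u x + f x + T) Ω μ :=
    hbound (huf.add (continuousOn_const (c := T)))
  have hle := hle₁.trans hle₂
  have hU0 : 0 ≤ᵐ[μ.restrict Ω] fun x => u x + T := by
    filter_upwards [ae_restrict_mem ho.measurableSet] with x hx
    exact zero_le_one.trans (huT x (subset_closure hx))
  have hUF0 : 0 ≤ᵐ[μ.restrict Ω] fun x => u x + f x + T := by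
    filter_upwards [ae_restrict_mem ho.measurableSet] with x hx
    have h1 := huT x (subset_closure hx)
    have h2 := (abs_le.1 (hf1 x)).1
    simp only [Pi.zero_apply]
    linarith
  rw [← ofReal_integral_eq_lintegral_ofReal hX (Eventually.of_forall hHφ₀),
    ← ofReal_integral_eq_lintegral_ofReal hY (Eventually.of_forall hHφ₁),
    ← ofReal_integral_eq_lintegral_ofReal hU hU0, ← ofReal_integral_eq_lintegral_ofReal hUF hUF0,
    ← ENNReal.ofReal_add (integral_nonneg hHφ₀) (integral_nonneg_of_ae hU0),
    ← ENNReal.ofReal_add (integral_nonneg hHφ₁) (integral_nonneg_of_ae hUF0),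
    ENNReal.ofReal_le_ofReal_iff
      (add_nonneg (integral_nonneg hHφ₁) (integral_nonneg_of_ae hUF0))] at hle
  have h1 : ∫ p, (φ₁ p - φ₀ p) ∂m = ∫ p, (φ₁ p - H p) ∂m - ∫ p, (φ₀ p - H p) ∂m := by
    rw [← integral_sub hY hX]
    simp
  have h2 : ∫ x in Ω, f x ∂μ = ∫ x in Ω, (u x + f x + T) ∂μ - ∫ x in Ω, (u x + T) ∂μ := by
    rw [← integral_sub hUF hU]
    congr 1
    ext x
    ring
  linarith

/-- The Euler–Lagrange equation, one inequality: the gradient of the conjugate of `u` pushes the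
Haar measure forward to `μ`, when tested with functions of compact support in `Ω`. -/
lemma integral_comp_gradient_le [m.IsAddHaarMeasure] (ho : IsOpen Ω) (hb : Bornology.IsBounded Ω)
    (hne : Ω.Nonempty) (hμ : μ Ω < ∞) (hg : ContinuousOn g (frontier Ω))
    (hD : ∀ x ∈ closure Ω, ‖x‖ ≤ D) (hφ : φ ∈ admissibleSet Ω g D T) (hφT : φ 0 ≤ T - 1)
    (hE : dualEnergy m μ Ω g T φ ≠ ∞)
    (hmin : IsMinOn (dualEnergy m μ Ω g T) (admissibleSet Ω g D T) φ)
    (huc : ContinuousOn (conjugateOn univ φ) (closure Ω))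
    (hug : EqOn (conjugateOn univ φ) g (frontier Ω)) {f : E → ℝ} (hf : Continuous f)
    (hfc : HasCompactSupport f) (hfΩ : tsupport f ⊆ Ω) (hf1 : ∀ x, |f x| ≤ 1) :
    Integrable (fun p => f (gradient (conjugateOn (closure Ω) (conjugateOn univ φ)) p)) m ∧
    ∫ p, f (gradient (conjugateOn (closure Ω) (conjugateOn univ φ)) p) ∂m ≤
      ∫ x in Ω, f x ∂μ := by
  set u := conjugateOn univ φ with hu
  set φ₀ := conjugateOn (closure Ω) u with hφ₀
  have hK := hb.isCompact_closure
  have hKne := hne.closure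
  have hφ₀L : LipschitzWith D φ₀ := lipschitzWith_conjugateOn hK hKne huc hD
  obtain ⟨r, hr, hrΩ⟩ := hfc.isCompact.exists_cthickening_subset_open ho hfΩ
  obtain ⟨R, hR⟩ := exists_forall_conjugateOn_add_eq hK hKne hr (hrΩ.trans subset_closure) huc hf
    fun x hx => image_eq_zero_of_notMem_tsupport hx
  set t : ℕ → ℝ := fun k => 1 / ((k : ℝ) + 1) with ht
  have ht0 : ∀ k, 0 < t k := fun k => by positivity
  have ht1 : ∀ k, t k ≤ 1 := fun k => by
    rw [ht, div_le_one (by positivity)]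
    linarith [(Nat.cast_nonneg k : (0 : ℝ) ≤ k)]
  have htlim : Tendsto t atTop (𝓝 0) := tendsto_one_div_add_atTop_nhds_zero_nat
  set ψ : ℕ → E → ℝ := fun k => conjugateOn (closure Ω) (fun x => u x + t k * f x) with hψ
  have hutf : ∀ k, ContinuousOn (fun x => u x + t k * f x) (closure Ω) := fun k =>
    huc.add (by fun_prop)
  have hψc : ∀ k, Continuous fun p => ψ k p - φ₀ p := fun k =>
    (lipschitzWith_conjugateOn hK hKne (hutf k) hD).continuous.sub hφ₀L.continuous
  have hψ0 : ∀ k p, p ∉ Metric.closedBall (0 : E) R → ψ k p - φ₀ p = 0 := fun k p hp => by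
    rw [mem_closedBall_zero_iff, not_le] at hp
    exact sub_eq_zero.2 (hR p hp (t k) ⟨(ht0 k).le, ht1 k⟩)
  have hψint : ∀ k, Integrable (fun p => ψ k p - φ₀ p) m := fun k =>
    (hψc k).integrable_of_hasCompactSupport
      (HasCompactSupport.intro (isCompact_closedBall 0 R) (hψ0 k))
  have hψle : ∀ k p, |ψ k p - φ₀ p| ≤ t k := fun k p => by
    have hsub : ∀ x ∈ closure Ω, |u x - (u x + t k * f x)| ≤ t k := fun x _ => by
      rw [sub_add_cancel_left, abs_neg, abs_mul, abs_of_pos (ht0 k)]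
      exact mul_le_of_le_one_right (ht0 k).le (hf1 x)
    have h1 := conjugateOn_le_add_of_abs_sub_le hK hKne huc hsub p
    have h2 := conjugateOn_le_add_of_abs_sub_le hK hKne (hutf k)
      (fun x hx => by rw [abs_sub_comm]; exact hsub x hx) p
    rw [abs_le]
    constructor <;> linarith
  set B : E → ℝ := (Metric.closedBall (0 : E) R).indicator fun _ => 1 with hB
  have hBint : Integrable B m :=
    (integrable_indicator_iff Metric.isClosed_closedBall.measurableSet).2
    (integrableOn_const (isCompact_closedBall 0 R).measure_lt_top.ne)
  have hBle : ∀ k, ∀ p, ‖(ψ k p - φ₀ p) / t k‖ ≤ B p := fun k p => by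
    by_cases hp : p ∈ Metric.closedBall (0 : E) R
    · rw [hB, indicator_of_mem hp, Real.norm_eq_abs, abs_div, abs_of_pos (ht0 k),
        div_le_one (ht0 k)]
      exact hψle k p
    · rw [hψ0 k p hp, hB, indicator_of_notMem hp]
      simp
  have hlim : ∀ᵐ p ∂m, Tendsto (fun k => (ψ k p - φ₀ p) / t k) atTop
      (𝓝 (-f (gradient φ₀ p))) := by
    filter_upwards [hφ₀L.ae_differentiableAt] with p hp
    exact tendsto_conjugateOn_add_sub_div hK hKne huc hf hp ht0 htlim
  have hdom := tendsto_integral_of_dominated_convergence B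
    (fun k => ((hψc k).div_const _).aestronglyMeasurable) hBint
    (fun k => Eventually.of_forall (hBle k)) hlim
  refine ⟨?_, ?_⟩
  · refine hBint.mono' (hf.measurable.comp (measurable_gradient φ₀)).aestronglyMeasurable ?_
    filter_upwards [hlim] with p hp
    rw [← norm_neg]
    exact le_of_tendsto' hp.norm fun k => hBle k p
  · have hnonneg : ∀ k, -∫ x in Ω, f x ∂μ ≤ ∫ p, (ψ k p - φ₀ p) / t k ∂m := fun k => by
      have h := integral_conjugateOn_sub_add_nonneg ho hb hne hμ hg hD hφ hφT hE hmin huc hug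
        (f := fun x => t k * f x) (by fun_prop)
        (fun x hx => by
          rw [image_eq_zero_of_notMem_tsupport (f := f) fun h =>
            hx.2 (by rw [ho.interior_eq]; exact hfΩ h), mul_zero])
        (fun x => by
          rw [abs_mul, abs_of_pos (ht0 k)]
          exact mul_le_one₀ (ht1 k) (abs_nonneg _) (hf1 x))
        (hψint k)
      rw [integral_const_mul] at h
      rw [integral_div, le_div_iff₀ (ht0 k)]
      change 0 ≤ ∫ p, (ψ k p - φ₀ p) ∂m + _ at h
      linarith
    have := ge_of_tendsto' hdom hnonneg
    rw [integral_neg] at this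
    linarith

end EulerLagrange

/-! ### Measures determined by compactly supported functions -/

section TestFunctions

variable {E : Type*} [NormedAddCommGroup E] [NormedSpace ℝ E] [FiniteDimensional ℝ E]
  [Nontrivial E] [MeasurableSpace E] [BorelSpace E]

/-- A measure is determined on a bounded open set, where it is finite, by the integrals of
continuous functions with compact support in that set: these increase to the indicator functions of
open subsets. -/
lemma restrict_eq_of_forall_lintegral_eq {ν μ : Measure E} {Ω : Set E} (ho : IsOpen Ω)
    (hb : Bornology.IsBounded Ω) (hμ : μ Ω < ∞)
    (h : ∀ f : E → ℝ, Continuous f → HasCompactSupport f → tsupport f ⊆ Ω →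
      (∀ x, f x ∈ Icc (0 : ℝ) 1) →
      ∫⁻ x, ENNReal.ofReal (f x) ∂ν = ∫⁻ x in Ω, ENNReal.ofReal (f x) ∂μ) :
    ν.restrict Ω = μ.restrict Ω := by
  have hU : ∀ U, IsOpen U → U ⊆ Ω → ν U = μ.restrict Ω U := by
    intro U hUo hUΩ
    have hne : (Uᶜ).Nonempty := by
      rw [nonempty_compl]
      rintro rfl
      exact NormedSpace.unbounded_univ ℝ E (hb.subset hUΩ)
    -- `f k` vanishes where the distance to `Uᶜ` is at most `1 / k`, so its support is inside `U`.
    set f : ℕ → E → ℝ := fun k x => min 1 (max 0 (k * Metric.infDist x Uᶜ - 1)) with hf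
    have hfc : ∀ k, Continuous (f k) := fun k => by
      have := Metric.continuous_infDist_pt (Uᶜ)
      fun_prop
    have hsupp : ∀ k, tsupport (f k) ⊆ U := fun k => by
      have h1 : tsupport (f k) ⊆ {x | 1 ≤ k * Metric.infDist x Uᶜ} := by
        refine closure_minimal (fun x hx => ?_) (isClosed_le continuous_const
          (continuous_const.mul (Metric.continuous_infDist_pt _)))
        by_contra hlt
        simp only [mem_ofPred_eq, not_le] at hlt
        refine hx ?_
        simp only [hf]
        rw [max_eq_left (by linarith), min_eq_right zero_le_one]
      refine h1.trans fun x hx => ?_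
      by_contra hxU
      have hx' : (1 : ℝ) ≤ k * Metric.infDist x Uᶜ := hx
      rw [Metric.infDist_zero_of_mem (show x ∈ Uᶜ from hxU), mul_zero] at hx'
      linarith
    have hmono : Monotone fun k x => ENNReal.ofReal (f k x) := fun i j hij x => by
      refine ENNReal.ofReal_le_ofReal (min_le_min_left _ (max_le_max_left _ ?_))
      have : (i : ℝ) ≤ j := by exact_mod_cast hij
      have := mul_le_mul_of_nonneg_right this (Metric.infDist_nonneg (x := x) (s := Uᶜ))
      linarith
    have hsup : ∀ x, ⨆ k, ENNReal.ofReal (f k x) = U.indicator 1 x := fun x => by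
      by_cases hx : x ∈ U
      · rw [indicator_of_mem hx, Pi.one_apply]
        refine le_antisymm (iSup_le fun k => ENNReal.ofReal_le_one.2 (min_le_left _ _)) ?_
        have hd : 0 < Metric.infDist x Uᶜ :=
          (hUo.isClosed_compl.notMem_iff_infDist_pos hne).1 (by simpa using hx)
        obtain ⟨k, hk⟩ := exists_nat_gt (2 / Metric.infDist x Uᶜ)
        rw [div_lt_iff₀ hd] at hk
        refine le_iSup_of_le k (ENNReal.one_le_ofReal.2 (le_min le_rfl (le_max_of_le_right ?_)))
        linarith
      · rw [indicator_of_notMem hx]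
        simp only [hf]
        rw [Metric.infDist_zero_of_mem (show x ∈ Uᶜ from hx)]
        simp
    have hlim : ∀ m : Measure E, m U = ⨆ k, ∫⁻ x, ENNReal.ofReal (f k x) ∂m := fun m => by
      rw [← lintegral_iSup (fun k => (hfc k).measurable.ennreal_ofReal) hmono]
      simp_rw [hsup]
      rw [lintegral_indicator_one hUo.measurableSet]
    rw [hlim ν, hlim (μ.restrict Ω)]
    exact iSup_congr fun k => h (f k) (hfc k)
      (hb.isCompact_closure.of_isClosed_subset (isClosed_tsupport _)
        ((hsupp k).trans (hUΩ.trans subset_closure))) ((hsupp k).trans hUΩ)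
      fun x => ⟨le_min zero_le_one (le_max_left _ _), min_le_left _ _⟩
  have hopen : ∀ U, IsOpen U → ν.restrict Ω U = μ.restrict Ω U := fun U hUo => by
    rw [Measure.restrict_apply hUo.measurableSet, hU _ (hUo.inter ho) inter_subset_right,
      Measure.restrict_apply (hUo.inter ho).measurableSet, inter_assoc, inter_self,
      Measure.restrict_apply hUo.measurableSet]
  have : Fact (μ Ω < ∞) := ⟨hμ⟩
  refine (ext_of_generate_finite {U | IsOpen U} ?_ isPiSystem_isOpen
    (fun U hU => (hopen U hU).symm) (hopen univ isOpen_univ).symm).symm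
  exact BorelSpace.measurable_eq

end TestFunctions

/-! ### Normal images -/

section NormalMapping

variable {n : ℕ} {Ω : Set (EuclideanSpace ℝ (Fin n))} {u v w : EuclideanSpace ℝ (Fin n) → ℝ}

/-- A supporting inequality on `Ω` extends to the closure when the function is continuous there. -/
lemma add_inner_le_of_mem_normalMapping (hu : ContinuousOn u (closure Ω))
    {x p y : EuclideanSpace ℝ (Fin n)} (hp : p ∈ normalMapping Ω u x) (hy : y ∈ closure Ω) :
    u x + inner ℝ p (y - x) ≤ u y :=
  le_on_closure hp (by fun_prop) hu hy

/-- Up to the null set where the conjugate of `u` is not differentiable, the normal image of `A` is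
the preimage of `A` under the gradient of the conjugate. -/
lemma normalImage_ae_eq_preimage_gradient (hb : Bornology.IsBounded Ω) (hne : Ω.Nonempty)
    (hu : ContinuousOn u (closure Ω)) {A : Set (EuclideanSpace ℝ (Fin n))} (hA : A ⊆ Ω) :
    normalImage Ω u A =ᵐ[volume] gradient (conjugateOn (closure Ω) u) ⁻¹' A := by
  have hK := hb.isCompact_closure
  obtain ⟨D, hD⟩ := hK.exists_bound_of_continuousOn continuousOn_id
  have hL : LipschitzWith D.toNNReal (conjugateOn (closure Ω) u) :=
    lipschitzWith_conjugateOn hK hne.closure hu fun x hx => (hD x hx).trans (Real.le_coe_toNNReal D)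
  filter_upwards [hL.ae_differentiableAt (μ := volume)] with p hp
  refine propext ⟨fun h => ?_, fun h => ?_⟩
  · obtain ⟨x, hxA, hx⟩ := mem_iUnion₂.1 h
    have heq : conjugateOn (closure Ω) u p = inner ℝ p x - u x := by
      refine le_antisymm (conjugateOn_le hne.closure fun y hy => ?_)
        (le_conjugateOn (bddAbove_conjugateOn hK hu p) (subset_closure (hA hxA)))
      have := add_inner_le_of_mem_normalMapping hu hx hy
      rw [inner_sub_right] at this
      linarith
    change gradient (conjugateOn (closure Ω) u) p ∈ A
    rwa [eq_gradient_of_conjugateOn_eq hK hu (subset_closure (hA hxA)) heq hp]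
  · obtain ⟨x, hx, heq⟩ := exists_conjugateOn_eq hK hne.closure hu p
    have hxA : x ∈ A := by
      rw [← eq_gradient_of_conjugateOn_eq hK hu hx heq hp]
      exact h
    refine mem_iUnion₂.2 ⟨x, hxA, fun y hy => ?_⟩
    have := le_conjugateOn (bddAbove_conjugateOn hK hu p) (subset_closure hy)
    rw [inner_sub_right]
    linarith

/-- If `u - p ·` takes a smaller value at some point than anywhere outside `G`, then its minimum
over the closure is attained in `G`. -/
lemma mem_normalImage_of_forall_lt (hb : Bornology.IsBounded Ω) (hu : ContinuousOn u (closure Ω))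
    {G : Set (EuclideanSpace ℝ (Fin n))} {p x : EuclideanSpace ℝ (Fin n)} (hx : x ∈ closure Ω)
    (h : ∀ y ∈ closure Ω, y ∉ G → u x - inner ℝ p x < u y - inner ℝ p y) :
    p ∈ normalImage Ω u G := by
  obtain ⟨z, hz, hmin⟩ := hb.isCompact_closure.exists_isMinOn ⟨x, hx⟩
    (hu.sub (by fun_prop : ContinuousOn (fun x => inner ℝ p x) (closure Ω)))
  have hzG : z ∈ G := by_contra fun hzG => (h z hz hzG).not_ge (hmin hx)
  refine mem_iUnion₂.2 ⟨z, hzG, fun y hy => ?_⟩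
  have : u z - inner ℝ p z ≤ u y - inner ℝ p y := hmin (subset_closure hy)
  rw [inner_sub_right]
  linarith

/-- The comparison of normal images on the set where `u < w`, for `w ≤ u` on the boundary. -/
lemma normalImage_subset_of_le_frontier (ho : IsOpen Ω) (hb : Bornology.IsBounded Ω)
    (hu : ContinuousOn u (closure Ω)) (hw : ContinuousOn w (closure Ω))
    (hle : ∀ y ∈ frontier Ω, w y ≤ u y) :
    normalImage Ω w {x ∈ Ω | u x < w x} ⊆ normalImage Ω u {x ∈ Ω | u x < w x} := by
  intro p hp
  obtain ⟨x, ⟨hxΩ, hx⟩, hpx⟩ := mem_iUnion₂.1 hp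
  refine mem_normalImage_of_forall_lt hb hu (subset_closure hxΩ) fun y hy hyG => ?_
  have hyw : w y ≤ u y := by
    by_cases hyΩ : y ∈ Ω
    · exact not_lt.1 fun hlt => hyG ⟨hyΩ, hlt⟩
    · exact hle y ⟨hy, by rwa [ho.interior_eq]⟩
  have := add_inner_le_of_mem_normalMapping hw hpx hy
  rw [inner_sub_right] at this
  linarith

lemma smul_normalImage_subset (a c : ℝ) (ha : 0 ≤ a) (A : Set (EuclideanSpace ℝ (Fin n))) :
    a • normalImage Ω v A ⊆ normalImage Ω (fun x => a * v x - c) A := by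
  rintro _ ⟨p, hp, rfl⟩
  obtain ⟨x, hxA, hx⟩ := mem_iUnion₂.1 hp
  refine mem_iUnion₂.2 ⟨x, hxA, fun y hy => ?_⟩
  have := mul_le_mul_of_nonneg_left (hx y hy) ha
  simp only [real_inner_smul_left]
  linarith

lemma convexOn_closure_of_continuousOn {E : Type*} [NormedAddCommGroup E] [NormedSpace ℝ E]
    {S : Set E} {f : E → ℝ} (hf : ConvexOn ℝ S f) (hc : ContinuousOn f (closure S)) :
    ConvexOn ℝ (closure S) f := by
  refine ⟨hf.1.closure, fun x hx y hy a b ha hb hab => ?_⟩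
  have hmem : ((x, y) : E × E) ∈ closure (S ×ˢ S) := by
    rw [closure_prod_eq]; exact ⟨hx, hy⟩
  refine le_on_closure (s := S ×ˢ S) (f := fun z : E × E => f (a • z.1 + b • z.2))
    (g := fun z : E × E => a • f z.1 + b • f z.2)
    (fun z hz => hf.2 hz.1 hz.2 ha hb hab) ?_ ?_ hmem
  · refine hc.comp (by fun_prop) fun z hz => ?_
    rw [closure_prod_eq] at hz
    exact hf.1.closure hz.1 hz.2 ha hb hab
  · rw [closure_prod_eq]
    refine ContinuousOn.add (ContinuousOn.const_smul ?_ a) (ContinuousOn.const_smul ?_ b)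
    · exact hc.comp continuousOn_fst fun z hz => hz.1
    · exact hc.comp continuousOn_snd fun z hz => hz.2

/-- The normal image of the set where `u < w` has positive measure: it contains all slopes close to
that of an affine function which lies below `w` and above `u` at the given point. -/
lemma volume_normalImage_pos (ho : IsOpen Ω) (hb : Bornology.IsBounded Ω)
    (hu : ContinuousOn u (closure Ω)) (hw : ContinuousOn w (closure Ω)) (hwc : ConvexOn ℝ Ω w)
    (hle : ∀ y ∈ frontier Ω, w y ≤ u y) {x : EuclideanSpace ℝ (Fin n)} (hx : x ∈ Ω)
    (hux : u x < w x) : 0 < volume (normalImage Ω u {x ∈ Ω | u x < w x}) := by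
  obtain ⟨D, hD⟩ := hb.isCompact_closure.exists_bound_of_continuousOn continuousOn_id
  have hxK := subset_closure hx
  have hD0 : 0 ≤ D := (norm_nonneg _).trans (hD x hxK)
  obtain ⟨l, c, hl, hlx⟩ := (convexOn_closure_of_continuousOn hwc hw).exists_affine_le_of_lt
    (𝕜 := ℝ) (a := (u x + w x) / 2) hxK (by linarith) isClosed_closure hw.lowerSemicontinuousOn
  set q := (InnerProductSpace.toDual ℝ (EuclideanSpace ℝ (Fin n))).symm l with hq
  have hql : ∀ y, inner ℝ q y = l y := fun y => InnerProductSpace.toDual_symm_apply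
  have hl' : ∀ y ∈ closure Ω, inner ℝ q y + c ≤ w y := fun y hy => by
    have := hl ⟨y, hy⟩
    simpa [hql] using this
  have hlx' : inner ℝ q x + c = (u x + w x) / 2 := by simpa [hql] using hlx
  set η := (w x - u x) / 2 with hη
  have hη0 : 0 < η := by rw [hη]; linarith
  refine (Metric.measure_ball_pos volume q (r := η / (2 * D + 1)) (by positivity)).trans_le
    (measure_mono fun p hp => mem_normalImage_of_forall_lt hb hu hxK fun y hy hyG => ?_)
  have hyw : w y ≤ u y := by
    by_cases hyΩ : y ∈ Ω
    · exact not_lt.1 fun hlt => hyG ⟨hyΩ, hlt⟩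
    · exact hle y ⟨hy, by rwa [ho.interior_eq]⟩
  have h1 : inner ℝ (q - p) (x - y) < η := by
    have hdist : ‖q - p‖ < η / (2 * D + 1) := by
      rw [← dist_eq_norm, dist_comm]; exact hp
    have h2 : ‖x - y‖ ≤ 2 * D := by
      have h3 := hD x hxK
      have h4 := hD y hy
      simp only [id] at h3 h4
      linarith [norm_sub_le x y]
    calc inner ℝ (q - p) (x - y) ≤ ‖q - p‖ * ‖x - y‖ := real_inner_le_norm _ _
      _ ≤ ‖q - p‖ * (2 * D + 1) := by gcongr; linarith
      _ < η := by rwa [← lt_div_iff₀ (by positivity)]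
  simp only [inner_sub_left, inner_sub_right] at h1
  have := hl' y hy
  linarith

end NormalMapping

/-! ### The Dirichlet problem -/

section Dirichlet

variable {n : ℕ} {Ω : Set (EuclideanSpace ℝ (Fin n))} {μ : Measure (EuclideanSpace ℝ (Fin n))}
  {g u v : EuclideanSpace ℝ (Fin n) → ℝ}

/-- Comparison of two solutions. If `v - u` had a positive maximum, dilating `v` to `(1 + e) v - c`
would give a set `G` where `(1 + e) ^ n * μ G ≤ μ G`, although `μ G` is positive and finite. -/
lemma IsDirichletSolution.le_of_isDirichletSolution (hn : 1 ≤ n) (ho : IsOpen Ω)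
    (hb : Bornology.IsBounded Ω) (hμ : μ Ω < ∞) (hu : IsDirichletSolution Ω μ g u)
    (hv : IsDirichletSolution Ω μ g v) {x : EuclideanSpace ℝ (Fin n)} (hx : x ∈ closure Ω) :
    v x ≤ u x := by
  by_contra! hlt
  have hxΩ : x ∈ Ω := by
    by_contra hxΩ
    have hxf : x ∈ frontier Ω := ⟨hx, by rwa [ho.interior_eq]⟩
    rw [hu.eqOn_frontier hxf, hv.eqOn_frontier hxf] at hlt
    exact lt_irrefl _ hlt
  obtain ⟨M, hM⟩ := hb.isCompact_closure.exists_bound_of_continuousOn hv.continuousOn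
  have hM0 : 0 ≤ M := (norm_nonneg _).trans (hM x hx)
  set d := v x - u x with hd
  have hd0 : 0 < d := sub_pos.2 hlt
  -- With this `e`, the dilation by `1 + e` moves `v` by at most `d / 4` on the closure.
  set e := d / (4 * (M + 1)) with he
  have he0 : 0 < e := by positivity
  have heM : ∀ y ∈ closure Ω, |e * v y| ≤ d / 4 := fun y hy => by
    rw [abs_mul, abs_of_pos he0]
    calc e * |v y| ≤ e * (M + 1) := by
          gcongr
          have := hM y hy
          rw [Real.norm_eq_abs] at this
          linarith
      _ = d / 4 := by rw [he]; field_simp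
  set w : EuclideanSpace ℝ (Fin n) → ℝ := fun y => (1 + e) * v y - d / 2 with hw
  have hwc : ContinuousOn w (closure Ω) := (continuousOn_const.mul hv.continuousOn).sub
    continuousOn_const
  have hwconv : ConvexOn ℝ Ω w :=
    (hv.isAleksandrovSolution.convexOn.smul (by positivity : 0 ≤ 1 + e)).sub
      (concaveOn_const (d / 2) hv.isAleksandrovSolution.convexOn.1)
  have hle : ∀ y ∈ frontier Ω, w y ≤ u y := fun y hy => by
    have h1 := (abs_le.1 (heM y hy.1)).2
    rw [hu.eqOn_frontier hy, ← hv.eqOn_frontier hy]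
    simp only [hw]
    linarith
  have hxw : u x < w x := by
    have h1 := (abs_le.1 (heM x hx)).1
    simp only [hw]
    linarith
  set G := {y ∈ Ω | u y < w y} with hG
  have hGo : IsOpen G := by
    have h1 : ContinuousOn (fun y => w y - u y) Ω :=
      (hwc.sub hu.continuousOn).mono subset_closure
    have h2 : G = Ω ∩ (fun y => w y - u y) ⁻¹' Ioi 0 := by
      ext y; simp [hG]
    rw [h2]
    exact h1.isOpen_inter_preimage ho isOpen_Ioi
  have hGΩ : G ⊆ Ω := fun y hy => hy.1
  have hGu : volume (normalImage Ω u G) = μ G :=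
    hu.isAleksandrovSolution.mongeAmpere_eq G hGΩ hGo.measurableSet
  have hGv : volume (normalImage Ω v G) = μ G :=
    hv.isAleksandrovSolution.mongeAmpere_eq G hGΩ hGo.measurableSet
  have hpos : 0 < μ G := by
    rw [← hGu]
    exact volume_normalImage_pos ho hb hu.continuousOn hwc hwconv hle hxΩ hxw
  have hfin : μ G ≠ ∞ := ((measure_mono hGΩ).trans_lt hμ).ne
  have hscale : ENNReal.ofReal ((1 + e) ^ n) * μ G ≤ μ G := by
    calc ENNReal.ofReal ((1 + e) ^ n) * μ G = volume ((1 + e) • normalImage Ω v G) := by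
          rw [Measure.addHaar_smul_of_nonneg _ (by positivity), finrank_euclideanSpace_fin, hGv]
      _ ≤ volume (normalImage Ω w G) :=
          measure_mono (smul_normalImage_subset _ _ (by positivity) _)
      _ ≤ volume (normalImage Ω u G) :=
          measure_mono (normalImage_subset_of_le_frontier ho hb hu.continuousOn hwc hle)
      _ = μ G := hGu
  have hone : 1 < ENNReal.ofReal ((1 + e) ^ n) :=
    ENNReal.one_lt_ofReal.2 (one_lt_pow₀ (by linarith) (by omega))
  have hstrict : 1 * μ G < ENNReal.ofReal ((1 + e) ^ n) * μ G :=
    ENNReal.mul_lt_mul_left hpos.ne' hfin hone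
  rw [one_mul] at hstrict
  exact hstrict.not_ge hscale

/-- Existence: the conjugate of a minimiser of the energy solves the Dirichlet problem. -/
lemma exists_isDirichletSolution (hn : 1 ≤ n) (ho : IsOpen Ω) (hb : Bornology.IsBounded Ω)
    (hc : Convex ℝ Ω) (hs : StrictConvex ℝ (closure Ω)) (hμ : μ Ω < ∞)
    (hg : ContinuousOn g (frontier Ω)) :
    ∃ u : EuclideanSpace ℝ (Fin n) → ℝ, IsDirichletSolution Ω μ g u := by
  rcases Ω.eq_empty_or_nonempty with rfl | hne
  · refine ⟨0, by simp, ⟨⟨convex_empty, by simp⟩, fun A hA _ => ?_⟩, by simp⟩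
    obtain rfl := subset_empty_iff.1 hA
    simp [mongeAmpere, normalImage]
  have : NeZero n := ⟨by omega⟩
  have hK := hb.isCompact_closure
  obtain ⟨D₀, hD₀⟩ := hK.exists_bound_of_continuousOn continuousOn_id
  have hD : ∀ x ∈ closure Ω, ‖x‖ ≤ D₀.toNNReal := fun x hx =>
    (hD₀ x hx).trans (Real.le_coe_toNNReal D₀)
  obtain ⟨T, φ, hφ, hφT, hE, hmin⟩ := exists_minimizer_lt volume μ ho hb hne hμ hg hD
  have hH : LipschitzWith D₀.toNNReal (conjugateOn (frontier Ω) g) :=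
    lipschitzWith_conjugateOn (isCompact_frontier_of_isBounded hb)
      (frontier_nonempty_of_isBounded hb hne) hg fun x hx => hD x hx.1
  obtain ⟨huc, hug⟩ := continuousOn_conjugateOn_and_eqOn_frontier volume ho hb hc hs hg hφ.2.1
    (hφ.1.sub hH) (ne_top_of_le_ne_top hE le_self_add)
  refine ⟨conjugateOn univ φ, huc, ⟨convexOn_conjugateOn univ_nonempty hc fun x hx =>
    bddAbove_of_conjugateOn_frontier_le ho hb hg hφ.2.1 (subset_closure hx),
    fun A hA hAm => ?_⟩, hug⟩
  set u := conjugateOn univ φ with hu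
  have hgrad := measurable_gradient (conjugateOn (closure Ω) u)
  have hmeas : (volume.map (gradient (conjugateOn (closure Ω) u))).restrict Ω = μ.restrict Ω := by
    refine restrict_eq_of_forall_lintegral_eq ho hb hμ fun f hf hfc hfΩ hf01 => ?_
    have hf1 : ∀ x, |f x| ≤ 1 := fun x => by
      rw [abs_of_nonneg (hf01 x).1]; exact (hf01 x).2
    obtain ⟨hint, hle⟩ := integral_comp_gradient_le ho hb hne hμ hg hD hφ hφT hE hmin huc hug hf
      hfc hfΩ hf1
    obtain ⟨-, hge⟩ := integral_comp_gradient_le ho hb hne hμ hg hD hφ hφT hE hmin huc hug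
      (f := fun x => -f x) hf.neg hfc.neg (by
        refine Subset.trans ?_ hfΩ
        exact (tsupport_neg f).le) (fun x => by rw [abs_neg]; exact hf1 x)
    rw [integral_neg, integral_neg, neg_le_neg_iff] at hge
    have hF : IntegrableOn f Ω μ := by
      have : Fact (μ Ω < ∞) := ⟨hμ⟩
      exact Integrable.of_bound hf.aestronglyMeasurable 1 (Eventually.of_forall hf1)
    rw [lintegral_map hf.measurable.ennreal_ofReal hgrad,
      ← ofReal_integral_eq_lintegral_ofReal hint (Eventually.of_forall fun p => (hf01 _).1),
      ← ofReal_integral_eq_lintegral_ofReal hF (Eventually.of_forall fun p => (hf01 _).1),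
      le_antisymm hle hge]
  calc mongeAmpere Ω u A = volume (gradient (conjugateOn (closure Ω) u) ⁻¹' A) :=
        measure_congr (normalImage_ae_eq_preimage_gradient hb hne huc hA)
    _ = (volume.map (gradient (conjugateOn (closure Ω) u))).restrict Ω A := by
        rw [Measure.restrict_eq_self _ hA, Measure.map_apply hgrad hAm]
    _ = μ A := by rw [hmeas, Measure.restrict_eq_self _ hA]

end Dirichlet

theorem theorem6p4 {n : ℕ} (hn : 1 ≤ n) (Ω : Set (EuclideanSpace ℝ (Fin n)))
    (hΩ_open : IsOpen Ω) (hΩ_bdd : Bornology.IsBounded Ω) (hΩ_convex : Convex ℝ Ω)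
    (hΩ_strict : StrictConvex ℝ (closure Ω))
    (μ : Measure (EuclideanSpace ℝ (Fin n))) (hμ : μ Ω < ∞)
    (g : EuclideanSpace ℝ (Fin n) → ℝ) (hg : ContinuousOn g (frontier Ω)) :
    (∃ u : EuclideanSpace ℝ (Fin n) → ℝ, IsDirichletSolution Ω μ g u) ∧
      ∀ u v : EuclideanSpace ℝ (Fin n) → ℝ, IsDirichletSolution Ω μ g u →
        IsDirichletSolution Ω μ g v → Set.EqOn u v (closure Ω) :=
  ⟨exists_isDirichletSolution hn hΩ_open hΩ_bdd hΩ_convex hΩ_strict hμ hg, fun _ _ hu hv _ hx =>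
    le_antisymm (hv.le_of_isDirichletSolution hn hΩ_open hΩ_bdd hμ hu hx)
      (hu.le_of_isDirichletSolution hn hΩ_open hΩ_bdd hμ hv hx)⟩
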